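/- Let $\theta\in(0,\pi/2)$, $\omega\in(0,1/2]$ and $m\in\mathbb Z$. Put \[ \mathsf{Gui}(\theta)=\Big\{(r,z)\in(0,\infty)\times\mathbb R:\ -\tfrac{\pi}{\sin\theta}<z,\ \max(0,z\tan\theta)<r<z\tan\theta+\tfrac{\pi}{\cos\theta}\Big\},\qquad \mathsf{Lay}(\theta)=\mathsf{Gui}(\theta)\times\mathbb S^1 , \] where $\mathbb S^1=\mathbb R/2\pi\mathbb Z$. Let $Q_{\omega,\theta}$ be the closure in $L^2(\mathsf{Lay}(\theta);r\,dr\,dz\,d\phi)$ of the quadratic form \[ u\mapsto\int_{\mathsf{Lay}(\theta)}\Big(|\partial_r u|^2+|\partial_z u|^2+\frac{|i\partial_\phi u-\omega u|^2}{r^2}\Big)r\,dr\,dz\,d\phi,\qquad u\in C_0^\infty(\mathsf{Lay}(\theta)), \] and let $(\pi^{[m]}u)(r,z)=\int_0^{2\pi}u(r,z,\phi)\,(2\pi)^{-1/2}e^{-im\phi}\,d\phi$. The flat fiber form is \[ \mathfrak q^{[m]}_{\omega,\theta}[u]=\int_{\mathsf{Gui}(\theta)}\Big(|\partial_r u|^2+|\partial_z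 u|^2+\frac{(m-\omega)^2-1/4}{r^2}|u|^2\Big)dr\,dz,\qquad \operatorname{dom}\mathfrak q^{[m]}_{\omega,\theta}=\big\{\sqrt r\,\pi^{[m]}u:\ u\in\operatorname{dom}Q_{\omega,\theta}\big\}\subset L^2(\mathsf{Gui}(\theta)), \] with $\partial_r u,\partial_z u$ weak derivatives. Let $H^1_0(\mathsf{Gui}(\theta))$ be the closure of $C_0^\infty(\mathsf{Gui}(\theta))$ in $H^1(\mathsf{Gui}(\theta))$. Then \[ \operatorname{dom}\mathfrak q^{[m]}_{\omega,\theta}=H^1_0(\mathsf{Gui}(\theta)). \] Moreover, $\int_{\mathsf{Gui}(\theta)}|u|^2r^{-2}\,dr\,dz<\infty$ and $\mathfrak q^{[m]}_{\omega,\theta}[u]\ge0$ for every $u\in\operatorname{dom}\mathfrak q^{[m]}_{\omega,\theta}$; and with $\|u\|_{+1,m}^2=\mathfrak q^{[m]}_{\omega,\theta}[u]+\|u\|^2_{L^2(\mathsf{Gui}(\theta))}$, the space $C_0^\infty(\mathsf{Gui}(\theta))$ is a form core, that is, it is contained in $\operatorname{dom}\mathfrak q^{[m]}_{\omega,\theta}$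 and dense there for $\|\cdot\|_{+1,m}$, and there are constants $C_1,C_2>0$, depending only on $\omega,\theta,m$, such that \[ C_1\|u\|_{H^1(\mathsf{Gui}(\theta))}\le\|u\|_{+1,m}\le C_2\|u\|_{H^1(\mathsf{Gui}(\theta))}\qquad\text{for all }u\in\operatorname{dom}\mathfrak q^{[m]}_{\omega,\theta}. \] -/

import Mathlib

open MeasureTheory Filter Topology
open scoped ComplexConjugate

noncomputable section

namespace ConicalLayer

/-! ### The geometry -/

/-- The meridian domain `Gui(θ)`; a point is `p = (r, z)`. -/
def Gui (θ : ℝ) : Set (ℝ × ℝ) :=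
  {p | 0 < p.1 ∧ -(Real.pi / Real.sin θ) < p.2 ∧ max 0 (p.2 * Real.tan θ) < p.1 ∧
    p.1 < p.2 * Real.tan θ + Real.pi / Real.cos θ}

/-- The circle `𝕊¹ = ℝ / 2πℤ`; its `volume` is `dφ`, of total mass `2π`. -/
abbrev S1 : Type := AddCircle (2 * Real.pi)

instance factTwoPiPos : Fact (0 < 2 * Real.pi) := ⟨Real.two_pi_pos⟩

/-- `dr dz` on `Gui(θ)`. -/
def flatMeasure (θ : ℝ) : Measure (ℝ × ℝ) := volume.restrict (Gui θ)

/-- `r dr dz` on `Gui(θ)`. -/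
def radialMeasure (θ : ℝ) : Measure (ℝ × ℝ) :=
  (flatMeasure θ).withDensity fun p => ENNReal.ofReal p.1

/-- `r dr dz dφ` on `Lay(θ) = Gui(θ) × 𝕊¹`. -/
def layerMeasure (θ : ℝ) : Measure ((ℝ × ℝ) × S1) := (radialMeasure θ).prod volume

/-- `L²(Gui(θ))`. -/
abbrev L2Flat (θ : ℝ) := Lp ℂ 2 (flatMeasure θ)

/-- `L²(Gui(θ); r dr dz)`. -/
abbrev L2Radial (θ : ℝ) := Lp ℂ 2 (radialMeasure θ)

/-- `L²_cyl(Lay(θ)) = L²(Gui(θ) × 𝕊¹; r dr dz dφ)`. -/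
abbrev L2Layer (θ : ℝ) := Lp ℂ 2 (layerMeasure θ)

/-! ### The form on the layer and its closure -/

/-- `v ∈ C₀^∞(Lay(θ))`. Smoothness on `ℝ² × 𝕊¹` is smoothness of the lift to `ℝ² × ℝ`. -/
structure IsLayerTest (θ : ℝ) (v : (ℝ × ℝ) × S1 → ℂ) : Prop where
  smooth : ContDiff ℝ ((⊤ : ℕ∞) : WithTop ℕ∞) (fun x : (ℝ × ℝ) × ℝ => v (x.1, (x.2 : S1)))
  compact : HasCompactSupport v
  support : tsupport v ⊆ Gui θ ×ˢ Set.univ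

/-- Classical `∂_r` in the layer. -/
def layerDr (v : (ℝ × ℝ) × S1 → ℂ) (x : (ℝ × ℝ) × S1) : ℂ :=
  fderiv ℝ (fun p => v (p, x.2)) x.1 (1, 0)

/-- Classical `∂_z` in the layer. -/
def layerDz (v : (ℝ × ℝ) × S1 → ℂ) (x : (ℝ × ℝ) × S1) : ℂ :=
  fderiv ℝ (fun p => v (p, x.2)) x.1 (0, 1)

/-- Classical `∂_φ` in the layer. -/
def layerDphi (v : (ℝ × ℝ) × S1 → ℂ) (x : (ℝ × ℝ) × S1) : ℂ :=
  deriv (fun t : ℝ => v (x.1, x.2 + (t : S1))) 0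

/-- The minimal form `‖(i∇ - A_ω) v‖²` on `C₀^∞(Lay(θ))`, with `A_ω = (ω / r) e_φ`,
in cylindrical coordinates. -/
def layerForm (θ ω : ℝ) (v : (ℝ × ℝ) × S1 → ℂ) : ℝ :=
  ∫ x, (‖layerDr v x‖ ^ 2 + ‖layerDz v x‖ ^ 2
    + ‖Complex.I * layerDphi v x - (ω : ℂ) * v x‖ ^ 2 / x.1.1 ^ 2) ∂(layerMeasure θ)

/-- The domain of the closure of the (closable) form `layerForm θ ω` on `C₀^∞(Lay(θ))`: the
`L²`-limits of sequences in `C₀^∞(Lay(θ))` that are Cauchy for the form. -/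
def layerFormDomain (θ ω : ℝ) : Set (L2Layer θ) :=
  {u | ∃ v : ℕ → (ℝ × ℝ) × S1 → ℂ, (∀ n, IsLayerTest θ (v n)) ∧
    Tendsto (fun n => eLpNorm (fun x => v n x - u x) 2 (layerMeasure θ)) atTop (𝓝 0) ∧
    Tendsto (fun k : ℕ × ℕ => layerForm θ ω (fun x => v k.1 x - v k.2 x)) atTop (𝓝 0)}

/-! ### The fibers -/

/-- `v_m(φ) = (2π)^{-1/2} e^{imφ}`. -/
def angularMode (m : ℤ) (φ : S1) : ℂ := ((Real.sqrt (2 * Real.pi) : ℝ) : ℂ)⁻¹ * fourier m φ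

/-- `(π^{[m]} u)(r, z) = ⟨u(r, z, ·), v_m⟩_{L²(𝕊¹)}`. -/
def angularProj (m : ℤ) (u : (ℝ × ℝ) × S1 → ℂ) (p : ℝ × ℝ) : ℂ :=
  ∫ φ : S1, u (p, φ) * conj (angularMode m φ)

/-- `dom 𝔣^{[m]}_{ω,θ} = π^{[m]}(dom Q_{ω,θ})`. -/
def fiberFormDomain (θ ω : ℝ) (m : ℤ) : Set (L2Radial θ) :=
  {w | ∃ u ∈ layerFormDomain θ ω, w =ᵐ[radialMeasure θ] angularProj m u}

/-- `dom 𝔮^{[m]}_{ω,θ} = U(dom 𝔣^{[m]}_{ω,θ})`, where `U w = √r w`. -/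
def flatFormDomain (θ ω : ℝ) (m : ℤ) : Set (L2Flat θ) :=
  {u | ∃ w ∈ fiberFormDomain θ ω m,
    u =ᵐ[flatMeasure θ] fun p => ((Real.sqrt p.1 : ℝ) : ℂ) * w p}

/-! ### Sobolev spaces on the meridian domain -/

/-- `φ ∈ C₀^∞(Gui(θ))`. -/
structure IsGuiTest (θ : ℝ) (φ : ℝ × ℝ → ℂ) : Prop where
  smooth : ContDiff ℝ ((⊤ : ℕ∞) : WithTop ℕ∞) φ
  compact : HasCompactSupport φ
  support : tsupport φ ⊆ Gui θ

/-- `C₀^∞(Gui(θ))` as a subset of `L²(Gui(θ))`. -/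
def testClasses (θ : ℝ) : Set (L2Flat θ) :=
  {u | ∃ φ, IsGuiTest θ φ ∧ u =ᵐ[flatMeasure θ] φ}

/-- `g` is the weak derivative of `u` in the direction `e` on `Gui(θ)`. -/
def IsWeakPartial (θ : ℝ) (e : ℝ × ℝ) (u g : L2Flat θ) : Prop :=
  ∀ φ, IsGuiTest θ φ →
    ∫ p, u p * fderiv ℝ φ p e ∂(flatMeasure θ) = -∫ p, g p * φ p ∂(flatMeasure θ)

open Classical in
/-- The weak derivative in `L²(Gui(θ))` in the direction `e`, where it exists (else `0`). -/
def weakPartial (θ : ℝ) (e : ℝ × ℝ) (u : L2Flat θ) : L2Flat θ :=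
  if h : ∃ g, IsWeakPartial θ e u g then h.choose else 0

/-- `H¹(Gui(θ))`. -/
def H1 (θ : ℝ) : Set (L2Flat θ) :=
  {u | (∃ g, IsWeakPartial θ (1, 0) u g) ∧ ∃ g, IsWeakPartial θ (0, 1) u g}

/-- The norm of `H¹(Gui(θ))`. -/
def h1Norm (θ : ℝ) (u : L2Flat θ) : ℝ :=
  Real.sqrt (‖u‖ ^ 2 + ‖weakPartial θ (1, 0) u‖ ^ 2 + ‖weakPartial θ (0, 1) u‖ ^ 2)

/-- `H₀¹(Gui(θ))`: the closure of `C₀^∞(Gui(θ))` in `H¹(Gui(θ))`. -/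
def H10 (θ : ℝ) : Set (L2Flat θ) :=
  {u | u ∈ H1 θ ∧ ∃ φ : ℕ → L2Flat θ, (∀ n, φ n ∈ testClasses θ) ∧
    Tendsto (fun n => h1Norm θ (φ n - u)) atTop (𝓝 0)}

/-! ### The flat fiber form -/

/-- The value `𝔮^{[m]}_{ω,θ}[u]`. -/
def flatForm (θ ω : ℝ) (m : ℤ) (u : L2Flat θ) : ℝ :=
  ∫ p, (‖weakPartial θ (1, 0) u p‖ ^ 2 + ‖weakPartial θ (0, 1) u p‖ ^ 2
    + (((m : ℝ) - ω) ^ 2 - 1 / 4) / p.1 ^ 2 * ‖u p‖ ^ 2) ∂(flatMeasure θ)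

/-- The form norm `‖u‖_{+1,m}`. -/
def flatFormNorm (θ ω : ℝ) (m : ℤ) (u : L2Flat θ) : ℝ :=
  Real.sqrt (flatForm θ ω m u + ‖u‖ ^ 2)

/-- `C₀^∞(Gui(θ))` is a core of the form `𝔮^{[m]}_{ω,θ}`. -/
def TestIsFormCore (θ ω : ℝ) (m : ℤ) : Prop :=
  testClasses θ ⊆ flatFormDomain θ ω m ∧
  ∀ u ∈ flatFormDomain θ ω m, ∃ φ : ℕ → L2Flat θ, (∀ n, φ n ∈ testClasses θ) ∧
    Tendsto (fun n => flatFormNorm θ ω m (φ n - u)) atTop (𝓝 0)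

end ConicalLayer

end

/-! The unitary substitution `φ = √r w` carries the weighted problem to the flat one. On test
functions, completing the square gives `∫ |√r ∂_r w|² = ∫ |∂_r φ|² - (1/4) ∫ |φ|²/r²`
(`integral_ground_state`, `radialEnergy_eq`). The left side is nonnegative, and this is Hardy's
inequality `∫ |φ|²/r² ≤ 4 ∫ |∂_r φ|²`. Hence the form with coefficient `c - 1/4` in front of
`|φ|²/r²` lies between `min 1 (4c)` and `1 + 4c` times the squared gradient norm as soon as `c > 0`
(`hardy_form_bounds`).

The domain is identified by moving approximating sequences between layer and meridian. From layer to
meridian, the projection on a mode commutes with `∂_r`, `∂_z` and diagonalises `∂_φ`, so Bessel's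
inequality on each circle bounds the energy of the projection by the layer form
(`radialEnergy_angularProj_le`). From meridian to layer, `r^{-1/2} φ` times the mode has layer form
exactly equal to the radial energy (`layerForm_tensor`). With the Hardy bounds, form-Cauchy
sequences on one side become `H¹`-Cauchy sequences on the other.

With these conventions the mode `m` of the layer form has coefficient `(m + ω)²`, while the flat
form has `(m - ω)²`. Both are positive because `0 < ω ≤ 1/2`, so the first serves for the domain and
the second for the norm equivalence. Hardy's inequality passes to `H₀¹` by Fatou
(`lintegral_hardy`). This makes the singular term finite and yields `norm_comparison`, from which
nonnegativity, the constants and the core property follow. -/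

noncomputable section

namespace ConicalLayer

/-! ### Geometry and measures -/

theorem isOpen_Gui (θ : ℝ) : IsOpen (Gui θ) := by
  have : Gui θ = {p : ℝ × ℝ | 0 < p.1} ∩ ({p | -(Real.pi / Real.sin θ) < p.2} ∩
      ({p | max 0 (p.2 * Real.tan θ) < p.1} ∩
        {p | p.1 < p.2 * Real.tan θ + Real.pi / Real.cos θ})) := rfl
  rw [this]
  exact (isOpen_lt (by fun_prop) (by fun_prop)).inter <|
    (isOpen_lt (by fun_prop) (by fun_prop)).inter <|
    (isOpen_lt (by fun_prop) (by fun_prop)).inter (isOpen_lt (by fun_prop) (by fun_prop))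

instance isLocallyFiniteMeasure_flatMeasure (θ : ℝ) :
    IsLocallyFiniteMeasure (flatMeasure θ) := by
  unfold flatMeasure; infer_instance

instance sFinite_flatMeasure (θ : ℝ) : SFinite (flatMeasure θ) := by
  unfold flatMeasure; infer_instance

instance isLocallyFiniteMeasure_radialMeasure (θ : ℝ) :
    IsLocallyFiniteMeasure (radialMeasure θ) :=
  IsLocallyFiniteMeasure.withDensity_ofReal continuous_fst

instance sFinite_radialMeasure (θ : ℝ) : SFinite (radialMeasure θ) := by
  unfold radialMeasure; infer_instance

instance isLocallyFiniteMeasure_layerMeasure (θ : ℝ) :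
    IsLocallyFiniteMeasure (layerMeasure θ) := by
  unfold layerMeasure; infer_instance

theorem ae_mem_Gui (θ : ℝ) : ∀ᵐ p ∂(flatMeasure θ), p ∈ Gui θ :=
  ae_restrict_mem (isOpen_Gui θ).measurableSet

theorem ae_fst_pos (θ : ℝ) : ∀ᵐ p ∂(flatMeasure θ), 0 < p.1 :=
  (ae_mem_Gui θ).mono fun _ hp => hp.1

/-- The density `r` is strictly positive on the domain, so both measures have the same null sets. -/
theorem radialMeasure_ae_iff {θ : ℝ} {P : ℝ × ℝ → Prop} :
    (∀ᵐ p ∂(radialMeasure θ), P p) ↔ ∀ᵐ p ∂(flatMeasure θ), P p := by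
  unfold radialMeasure
  rw [ae_withDensity_iff (by fun_prop)]
  refine ⟨fun h => ?_, fun h => h.mono fun p hp _ => hp⟩
  filter_upwards [h, ae_fst_pos θ] with p hp hpos
  exact hp (by simpa using hpos)

theorem integral_flatMeasure_eq {θ : ℝ} {f : ℝ × ℝ → ℂ}
    (hf : ∀ p ∉ Gui θ, f p = 0) : ∫ p, f p ∂(flatMeasure θ) = ∫ p, f p :=
  setIntegral_eq_integral_of_forall_compl_eq_zero hf

/-! ### Test functions on the meridian domain -/

namespace IsGuiTest

variable {θ : ℝ} {φ ψ : ℝ × ℝ → ℂ}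

theorem eq_zero_of_notMem (hφ : IsGuiTest θ φ) {p : ℝ × ℝ} (hp : p ∉ Gui θ) : φ p = 0 :=
  image_eq_zero_of_notMem_tsupport fun h => hp (hφ.support h)

theorem differentiable (hφ : IsGuiTest θ φ) : Differentiable ℝ φ :=
  hφ.smooth.differentiable (by simp)

theorem sub (hφ : IsGuiTest θ φ) (hψ : IsGuiTest θ ψ) :
    IsGuiTest θ (fun p => φ p - ψ p) where
  smooth := hφ.smooth.sub hψ.smooth
  compact := hφ.compact.sub hψ.compact
  support := (tsupport_sub φ ψ).trans (Set.union_subset hφ.support hψ.support)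

theorem fderiv_apply (hφ : IsGuiTest θ φ) (e : ℝ × ℝ) :
    IsGuiTest θ (fun p => fderiv ℝ φ p e) where
  smooth := (hφ.smooth.fderiv_right (m := ((⊤ : ℕ∞) : WithTop ℕ∞)) (by simp)).clm_apply
    contDiff_const
  compact := hφ.compact.fderiv_apply ℝ e
  support := (tsupport_fderiv_apply_subset ℝ e).trans hφ.support

/-- Multiplication by a function that is smooth where `r > 0` preserves test functions. -/
theorem mul_left {h : ℝ × ℝ → ℂ} (hφ : IsGuiTest θ φ)
    (hh : ∀ p : ℝ × ℝ, 0 < p.1 → ContDiffAt ℝ ((⊤ : ℕ∞) : WithTop ℕ∞) h p) :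
    IsGuiTest θ (fun p => h p * φ p) where
  smooth := by
    refine contDiff_iff_contDiffAt.2 fun p => ?_
    by_cases hp : p ∈ tsupport φ
    · exact (hh p (hφ.support hp).1).mul hφ.smooth.contDiffAt
    · have : (fun p => h p * φ p) =ᶠ[𝓝 p] fun _ => 0 := by
        filter_upwards [notMem_tsupport_iff_eventuallyEq.1 hp] with q hq
        simp [hq]
      exact contDiffAt_const.congr_of_eventuallyEq this
  compact := hφ.compact.mul_left
  support := tsupport_mul_subset_right.trans hφ.support

theorem integrable (hφ : IsGuiTest θ φ) : Integrable φ (flatMeasure θ) :=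
  hφ.smooth.continuous.integrable_of_hasCompactSupport hφ.compact

theorem memLp (hφ : IsGuiTest θ φ) : MemLp φ 2 (flatMeasure θ) :=
  hφ.smooth.continuous.memLp_of_hasCompactSupport hφ.compact

theorem star_apply (hφ : IsGuiTest θ φ) : IsGuiTest θ (fun p => conj (φ p)) where
  smooth := Complex.conjCLE.contDiff.comp hφ.smooth
  compact := hφ.compact.comp_left (g := fun z => (starRingEnd ℂ) z) (by simp)
  support := (tsupport_comp_subset (g := fun z => (starRingEnd ℂ) z) (by simp) φ).trans hφ.support

theorem mul (hφ : IsGuiTest θ φ) (hψ : IsGuiTest θ ψ) : IsGuiTest θ (fun p => φ p * ψ p) :=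
  hψ.mul_left fun _ _ => hφ.smooth.contDiffAt

theorem fderiv_conj (hφ : IsGuiTest θ φ) (e p : ℝ × ℝ) :
    fderiv ℝ (fun p => (starRingEnd ℂ) (φ p)) p e = (starRingEnd ℂ) (fderiv ℝ φ p e) := by
  have := (Complex.conjCLE.toContinuousLinearMap.hasFDerivAt.comp p
    (hφ.differentiable p).hasFDerivAt)
  have h2 := this.fderiv
  have : fderiv ℝ (fun p => (starRingEnd ℂ) (φ p)) p = _ := h2
  rw [this]; simp

/-- Integration by parts on the meridian domain. -/
theorem integral_mul_fderiv (hφ : IsGuiTest θ φ) (hψ : IsGuiTest θ ψ) (e : ℝ × ℝ) :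
    ∫ p, φ p * fderiv ℝ ψ p e ∂(flatMeasure θ) =
      -∫ p, fderiv ℝ φ p e * ψ p ∂(flatMeasure θ) := by
  rw [integral_flatMeasure_eq fun p hp => by simp [hφ.eq_zero_of_notMem hp],
    integral_flatMeasure_eq fun p hp => by simp [hψ.eq_zero_of_notMem hp]]
  have int : ∀ {f : ℝ × ℝ → ℂ}, IsGuiTest θ f → Integrable f := fun hf =>
    hf.smooth.continuous.integrable_of_hasCompactSupport hf.compact
  exact integral_mul_fderiv_eq_neg_fderiv_mul_of_integrable
    (int ((hφ.fderiv_apply e).mul hψ)) (int (hφ.mul (hψ.fderiv_apply e)))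
    (int (hφ.mul hψ)) (fun p _ => hφ.differentiable p) (fun p _ => hψ.differentiable p)

theorem integrable_norm_sq (hφ : IsGuiTest θ φ) :
    Integrable (fun p => ‖φ p‖ ^ 2) (flatMeasure θ) :=
  hφ.memLp.integrable_norm_pow (by simp)

theorem contDiffAt_fst_inv {p : ℝ × ℝ} (hp : 0 < p.1) :
    ContDiffAt ℝ ((⊤ : ℕ∞) : WithTop ℕ∞) (fun p : ℝ × ℝ => ((p.1⁻¹ : ℝ) : ℂ)) p :=
  Complex.ofRealCLM.contDiff.contDiffAt.comp p (contDiffAt_fst.inv hp.ne')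

theorem inv_fst_mul (hφ : IsGuiTest θ φ) : IsGuiTest θ (fun p => ((p.1⁻¹ : ℝ) : ℂ) * φ p) :=
  hφ.mul_left fun _ => contDiffAt_fst_inv

theorem integrable_norm_sq_div (hφ : IsGuiTest θ φ) :
    Integrable (fun p => ‖φ p‖ ^ 2 / p.1 ^ 2) (flatMeasure θ) := by
  refine hφ.inv_fst_mul.integrable_norm_sq.congr (.of_forall fun p => ?_)
  simp only [norm_mul, mul_pow, Complex.norm_real, norm_inv, Real.norm_eq_abs, inv_pow, sq_abs]
  ring

/-! ### Hardy's inequality -/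

theorem integrable_re_conj_mul_fderiv (hφ : IsGuiTest θ φ) :
    Integrable (fun p : ℝ × ℝ => 2 * (((starRingEnd ℂ) (φ p) *
      fderiv ℝ φ p (1, 0)).re / p.1)) (flatMeasure θ) := by
  refine Integrable.const_mul ?_ 2
  refine (hφ.star_apply.mul (hφ.fderiv_apply (1, 0)).inv_fst_mul).integrable.re.congr
    (.of_forall fun p => ?_)
  simp
  ring

/-- This is `∫ ∂_r|φ|² / r = ∫ |φ|²/r²`, obtained by integrating `conj φ` by parts against `φ / r`.
There is no boundary term at `r = 0`, since the support is compact in `r > 0`. -/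
theorem integral_re_conj_mul_fderiv (hφ : IsGuiTest θ φ) :
    ∫ p, 2 * (((starRingEnd ℂ) (φ p) * fderiv ℝ φ p (1, 0)).re / p.1) ∂(flatMeasure θ) =
      ∫ p, ‖φ p‖ ^ 2 / p.1 ^ 2 ∂(flatMeasure θ) := by
  have key := hφ.star_apply.integral_mul_fderiv hφ.inv_fst_mul (1, 0)
  have i1 := (hφ.star_apply.mul (hφ.inv_fst_mul.fderiv_apply (1, 0))).integrable
  have i2 := ((hφ.star_apply.fderiv_apply (1, 0)).mul hφ.inv_fst_mul).integrable
  -- Both sides are gathered under one integral because only the real part of the summed integrand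
  -- has the desired form `2 Re(conj φ ∂_r φ)/r - |φ|²/r²`.
  rw [eq_neg_iff_add_eq_zero, ← integral_add i1 i2] at key
  have hre := congrArg Complex.re key
  have hre' := integral_re (i1.add i2)
  simp only [Pi.add_apply, RCLike.re_eq_complex_re] at hre'
  rw [← hre', Complex.zero_re] at hre
  rw [← sub_eq_zero, ← integral_sub _ hφ.integrable_norm_sq_div]
  · refine Eq.trans (integral_congr_ae ?_) hre
    filter_upwards [ae_fst_pos θ] with p hp
    have hd : fderiv ℝ (fun p : ℝ × ℝ => ((p.1⁻¹ : ℝ) : ℂ) * φ p) p (1, 0) =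
        ((p.1⁻¹ : ℝ) : ℂ) * fderiv ℝ φ p (1, 0) - (((p.1 ^ 2)⁻¹ : ℝ) : ℂ) * φ p := by
      have h1 : HasFDerivAt (fun p : ℝ × ℝ => ((p.1⁻¹ : ℝ) : ℂ))
          (Complex.ofRealCLM.comp ((-(p.1 ^ 2)⁻¹) • ContinuousLinearMap.fst ℝ ℝ ℝ)) p :=
        Complex.ofRealCLM.hasFDerivAt.comp p
          ((hasDerivAt_inv hp.ne').comp_hasFDerivAt p hasFDerivAt_fst)
      rw [(h1.fun_mul (hφ.differentiable p).hasFDerivAt).fderiv]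
      simp
      ring
    rw [hd, hφ.fderiv_conj]
    have h2 : ‖φ p‖ ^ 2 = (φ p).re ^ 2 + (φ p).im ^ 2 := by
      rw [Complex.sq_norm, Complex.normSq_apply]; ring
    rw [h2]
    simp only [Complex.mul_re, Complex.add_re, Complex.sub_re, Complex.sub_im, Complex.mul_im,
      Complex.conj_re, Complex.conj_im, Complex.ofReal_re, Complex.ofReal_im]
    field_simp
    ring
  · exact hφ.integrable_re_conj_mul_fderiv

/-- The ground state representation: `|r^{1/2} ∂_r (r^{-1/2} φ)|²` integrates to the Hardy form. -/
theorem integral_ground_state (hφ : IsGuiTest θ φ) :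
    ∫ p, ‖fderiv ℝ φ p (1, 0) - ((p.1⁻¹ : ℝ) : ℂ) * φ p / 2‖ ^ 2 ∂(flatMeasure θ) =
      ∫ p, ‖fderiv ℝ φ p (1, 0)‖ ^ 2 ∂(flatMeasure θ)
        - 1 / 4 * ∫ p, ‖φ p‖ ^ 2 / p.1 ^ 2 ∂(flatMeasure θ) := by
  have h := hφ.integral_re_conj_mul_fderiv
  have i0 := (hφ.fderiv_apply (1, 0)).integrable_norm_sq
  have i1 := hφ.integrable_norm_sq_div
  have i2 := hφ.integrable_re_conj_mul_fderiv
  have e : ∀ p : ℝ × ℝ, ‖fderiv ℝ φ p (1, 0) - ((p.1⁻¹ : ℝ) : ℂ) * φ p / 2‖ ^ 2 =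
      ‖fderiv ℝ φ p (1, 0)‖ ^ 2 - 1 / 2 * (2 * (((starRingEnd ℂ) (φ p) *
      fderiv ℝ φ p (1, 0)).re / p.1)) + 1 / 4 * (‖φ p‖ ^ 2 / p.1 ^ 2) := by
    intro p
    simp only [Complex.sq_norm, Complex.normSq_apply, Complex.sub_re, Complex.sub_im,
      Complex.mul_re, Complex.mul_im, Complex.div_ofNat_re, Complex.div_ofNat_im,
      Complex.conj_re, Complex.conj_im, Complex.ofReal_re, Complex.ofReal_im]
    ring
  simp_rw [e]
  rw [integral_add (by exact i0.sub (i2.const_mul _)) (i1.const_mul _), integral_sub i0 (i2.const_mul _),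
    integral_const_mul (1 / 2), integral_const_mul (1 / 4), h]
  ring

/-- Hardy's inequality on test functions. -/
theorem hardy (hφ : IsGuiTest θ φ) :
    ∫ p, ‖φ p‖ ^ 2 / p.1 ^ 2 ∂(flatMeasure θ) ≤
      4 * ∫ p, ‖fderiv ℝ φ p (1, 0)‖ ^ 2 ∂(flatMeasure θ) := by
  have h := hφ.integral_ground_state
  have : 0 ≤ ∫ p, ‖fderiv ℝ φ p (1, 0) - ((p.1⁻¹ : ℝ) : ℂ) * φ p / 2‖ ^ 2 ∂(flatMeasure θ) :=
    integral_nonneg fun p => by positivity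
  linarith

end IsGuiTest

variable {θ : ℝ}

/-! ### Weak derivatives -/

theorem norm_sq_eq_integral (u : L2Flat θ) : ‖u‖ ^ 2 = ∫ p, ‖u p‖ ^ 2 ∂(flatMeasure θ) := by
  have h := (MeasureTheory.L2.inner_def (𝕜 := ℂ) u u).symm
  rw [inner_self_eq_norm_sq_to_K] at h
  simp only [inner_self_eq_norm_sq_to_K] at h
  have h' : ((∫ p, ‖u p‖ ^ 2 ∂(flatMeasure θ) : ℝ) : ℂ) = ((‖u‖ ^ 2 : ℝ) : ℂ) := by
    rw [← integral_complex_ofReal]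
    simpa using h
  exact (Complex.ofReal_injective h').symm

theorem integrable_norm_sq (u : L2Flat θ) :
    Integrable (fun p => ‖u p‖ ^ 2) (flatMeasure θ) :=
  (Lp.memLp u).integrable_norm_pow (by simp)

theorem integrable_mul_test (u : L2Flat θ) {φ : ℝ × ℝ → ℂ} (hφ : IsGuiTest θ φ) :
    Integrable (fun p => u p * φ p) (flatMeasure θ) :=
  (Lp.memLp u).integrable_mul hφ.memLp

/-- The fundamental lemma of the calculus of variations; real-valued test functions already suffice.
-/
theorem IsWeakPartial.unique {e : ℝ × ℝ} {u g g' : L2Flat θ} (h : IsWeakPartial θ e u g)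
    (h' : IsWeakPartial θ e u g') : g = g' := by
  have hloc : LocallyIntegrable (fun p => g p - g' p) (flatMeasure θ) :=
    ((Lp.memLp g).locallyIntegrable (by norm_num)).sub
      ((Lp.memLp g').locallyIntegrable (by norm_num))
  have := (isOpen_Gui θ).ae_eq_zero_of_integral_contDiff_smul_eq_zero
    (μ := flatMeasure θ) (hloc.locallyIntegrableOn _) (fun f hf hc hs => by
      have hφ : IsGuiTest θ (fun p => (f p : ℂ)) :=
        ⟨Complex.ofRealCLM.contDiff.comp hf,
          hc.comp_left (g := fun x : ℝ => (x : ℂ)) (by simp),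
          (tsupport_comp_subset (g := fun x : ℝ => (x : ℂ)) (by simp) f).trans hs⟩
      have h2 := (h _ hφ).symm.trans (h' _ hφ)
      rw [neg_inj, ← sub_eq_zero, ← integral_sub (integrable_mul_test g hφ)
        (integrable_mul_test g' hφ)] at h2
      rw [← h2]
      refine integral_congr_ae (.of_forall fun p => ?_)
      simp only [Complex.real_smul]
      ring)
  refine Lp.ext ?_
  filter_upwards [this, ae_mem_Gui θ] with p hp hG
  exact sub_eq_zero.1 (hp hG)

/-- Uniqueness makes the arbitrary choice in `weakPartial` irrelevant, so any known weak derivative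
computes it. -/
theorem IsWeakPartial.weakPartial_eq {e : ℝ × ℝ} {u g : L2Flat θ} (h : IsWeakPartial θ e u g) :
    weakPartial θ e u = g := by
  have hex : ∃ g, IsWeakPartial θ e u g := ⟨g, h⟩
  rw [weakPartial, dif_pos hex]
  exact hex.choose_spec.unique h

theorem isWeakPartial_weakPartial {e : ℝ × ℝ} {u : L2Flat θ} (h : ∃ g, IsWeakPartial θ e u g) :
    IsWeakPartial θ e u (weakPartial θ e u) := by
  obtain ⟨g, hg⟩ := h
  rwa [hg.weakPartial_eq]

theorem IsWeakPartial.sub {e : ℝ × ℝ} {u u' g g' : L2Flat θ} (h : IsWeakPartial θ e u g)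
    (h' : IsWeakPartial θ e u' g') : IsWeakPartial θ e (u - u') (g - g') := by
  intro φ hφ
  have aux : ∀ (a b : L2Flat θ) {ψ : ℝ × ℝ → ℂ}, IsGuiTest θ ψ →
      ∫ p, (a - b : L2Flat θ) p * ψ p ∂(flatMeasure θ) =
        ∫ p, a p * ψ p ∂(flatMeasure θ) - ∫ p, b p * ψ p ∂(flatMeasure θ) := by
    intro a b ψ hψ
    rw [← integral_sub (integrable_mul_test a hψ) (integrable_mul_test b hψ)]
    refine integral_congr_ae ?_
    filter_upwards [Lp.coeFn_sub a b] with p hp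
    rw [hp, Pi.sub_apply]
    ring
  rw [aux u u' (hφ.fderiv_apply e), aux g g' hφ, h φ hφ, h' φ hφ]
  ring

/-- The class in `L²(Gui(θ))` of a test function. -/
def IsGuiTest.toL2 {φ : ℝ × ℝ → ℂ} (hφ : IsGuiTest θ φ) : L2Flat θ := hφ.memLp.toLp φ

theorem IsGuiTest.coeFn_toL2 {φ : ℝ × ℝ → ℂ} (hφ : IsGuiTest θ φ) :
    hφ.toL2 =ᵐ[flatMeasure θ] φ := hφ.memLp.coeFn_toLp

theorem IsGuiTest.toL2_mem {φ : ℝ × ℝ → ℂ} (hφ : IsGuiTest θ φ) : hφ.toL2 ∈ testClasses θ :=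
  ⟨φ, hφ, hφ.coeFn_toL2⟩

theorem IsGuiTest.norm_sq_toL2 {φ : ℝ × ℝ → ℂ} (hφ : IsGuiTest θ φ) :
    ‖hφ.toL2‖ ^ 2 = ∫ p, ‖φ p‖ ^ 2 ∂(flatMeasure θ) := by
  rw [norm_sq_eq_integral]
  refine integral_congr_ae ?_
  filter_upwards [hφ.coeFn_toL2] with p hp
  rw [hp]

theorem IsGuiTest.toL2_sub {φ ψ : ℝ × ℝ → ℂ} (hφ : IsGuiTest θ φ) (hψ : IsGuiTest θ ψ) :
    (hφ.sub hψ).toL2 = hφ.toL2 - hψ.toL2 := by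
  refine Lp.ext ?_
  filter_upwards [hφ.coeFn_toL2, hψ.coeFn_toL2, (hφ.sub hψ).coeFn_toL2,
    Lp.coeFn_sub hφ.toL2 hψ.toL2] with p h1 h2 h3 h4
  rw [h3, h4, Pi.sub_apply, h1, h2]

theorem IsGuiTest.fderiv_sub {φ ψ : ℝ × ℝ → ℂ} (hφ : IsGuiTest θ φ) (hψ : IsGuiTest θ ψ)
    (p e : ℝ × ℝ) :
    fderiv ℝ (fun p => φ p - ψ p) p e = fderiv ℝ φ p e - fderiv ℝ ψ p e := by
  rw [fderiv_fun_sub (hφ.differentiable p) (hψ.differentiable p)]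
  rfl

theorem IsGuiTest.norm_sq_toL2_fderiv_sub {φ ψ : ℝ × ℝ → ℂ} (hφ : IsGuiTest θ φ)
    (hψ : IsGuiTest θ ψ) (e : ℝ × ℝ) :
    ‖(hφ.fderiv_apply e).toL2 - (hψ.fderiv_apply e).toL2‖ ^ 2 =
      ∫ p, ‖fderiv ℝ (fun p => φ p - ψ p) p e‖ ^ 2 ∂(flatMeasure θ) := by
  rw [← IsGuiTest.toL2_sub, IsGuiTest.norm_sq_toL2]
  simp_rw [hφ.fderiv_sub hψ]

theorem IsGuiTest.isWeakPartial {φ : ℝ × ℝ → ℂ} (hφ : IsGuiTest θ φ) (e : ℝ × ℝ) :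
    IsWeakPartial θ e hφ.toL2 (hφ.fderiv_apply e).toL2 := by
  intro ψ hψ
  refine Eq.trans (Eq.trans (integral_congr_ae ?_) (hφ.integral_mul_fderiv hψ e))
    (congrArg _ (integral_congr_ae ?_))
  · filter_upwards [hφ.coeFn_toL2] with p hp
    rw [hp]
  · filter_upwards [(hφ.fderiv_apply e).coeFn_toL2] with p hp
    rw [hp]

theorem tendsto_integral_mul_test {φ : ℝ × ℝ → ℂ} (hφ : IsGuiTest θ φ) {u : ℕ → L2Flat θ}
    {v : L2Flat θ} (h : Tendsto u atTop (𝓝 v)) :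
    Tendsto (fun n => ∫ p, u n p * φ p ∂(flatMeasure θ)) atTop
      (𝓝 (∫ p, v p * φ p ∂(flatMeasure θ))) := by
  have e : ∀ w : L2Flat θ, ∫ p, w p * φ p ∂(flatMeasure θ) =
      inner ℂ hφ.star_apply.toL2 w := by
    intro w
    rw [MeasureTheory.L2.inner_def]
    refine integral_congr_ae ?_
    filter_upwards [hφ.star_apply.coeFn_toL2] with p hp
    rw [hp]
    simp [RCLike.inner_apply]
  simp_rw [e]
  exact tendsto_const_nhds.inner h

/-- Weak differentiation is a closed operator: its defining identity involves only pairings with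
test functions, which are `L²`-continuous. -/
theorem isWeakPartial_of_tendsto {e : ℝ × ℝ} {u g : ℕ → L2Flat θ} {v f : L2Flat θ}
    (h : ∀ n, IsWeakPartial θ e (u n) (g n)) (hu : Tendsto u atTop (𝓝 v))
    (hg : Tendsto g atTop (𝓝 f)) : IsWeakPartial θ e v f := by
  intro φ hφ
  refine tendsto_nhds_unique (tendsto_integral_mul_test (hφ.fderiv_apply e) hu) ?_
  simp_rw [fun n => h n φ hφ]
  exact (tendsto_integral_mul_test hφ hg).neg

/-! ### The space `H₀¹` -/

theorem testClasses_eq_toL2 {u : L2Flat θ} (hu : u ∈ testClasses θ) :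
    ∃ (φ : ℝ × ℝ → ℂ) (hφ : IsGuiTest θ φ), u = hφ.toL2 := by
  obtain ⟨φ, hφ, h⟩ := hu
  exact ⟨φ, hφ, Lp.ext (h.trans hφ.coeFn_toL2.symm)⟩

/-- `φ n → u` in `H¹(Gui(θ))`, where `u` has the weak gradient `(g, k)`. -/
structure H1Approx (φ : ℕ → ℝ × ℝ → ℂ) (u g k : L2Flat θ) : Prop where
  test : ∀ n, IsGuiTest θ (φ n)
  tendsto : Tendsto (fun n => (test n).toL2) atTop (𝓝 u)
  tendsto_r : Tendsto (fun n => ((test n).fderiv_apply (1, 0)).toL2) atTop (𝓝 g)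
  tendsto_z : Tendsto (fun n => ((test n).fderiv_apply (0, 1)).toL2) atTop (𝓝 k)

namespace H1Approx

variable {φ : ℕ → ℝ × ℝ → ℂ} {u g k : L2Flat θ}

theorem isWeakPartial_r (h : H1Approx φ u g k) : IsWeakPartial θ (1, 0) u g :=
  isWeakPartial_of_tendsto (fun n => (h.test n).isWeakPartial _) h.tendsto h.tendsto_r

theorem isWeakPartial_z (h : H1Approx φ u g k) : IsWeakPartial θ (0, 1) u k :=
  isWeakPartial_of_tendsto (fun n => (h.test n).isWeakPartial _) h.tendsto h.tendsto_z

theorem tendsto_h1Norm (h : H1Approx φ u g k) :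
    Tendsto (fun n => h1Norm θ ((h.test n).toL2 - u)) atTop (𝓝 0) := by
  have e : ∀ n, h1Norm θ ((h.test n).toL2 - u) =
      Real.sqrt (‖(h.test n).toL2 - u‖ ^ 2 + ‖((h.test n).fderiv_apply (1, 0)).toL2 - g‖ ^ 2
        + ‖((h.test n).fderiv_apply (0, 1)).toL2 - k‖ ^ 2) := fun n => by
    rw [h1Norm, (((h.test n).isWeakPartial _).sub h.isWeakPartial_r).weakPartial_eq,
      (((h.test n).isWeakPartial _).sub h.isWeakPartial_z).weakPartial_eq]
  simp_rw [e]
  have h0 := (tendsto_iff_norm_sub_tendsto_zero.1 h.tendsto).pow 2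
  have h1 := (tendsto_iff_norm_sub_tendsto_zero.1 h.tendsto_r).pow 2
  have h2 := (tendsto_iff_norm_sub_tendsto_zero.1 h.tendsto_z).pow 2
  simpa using ((h0.add h1).add h2).sqrt

theorem mem_H10 (h : H1Approx φ u g k) : u ∈ H10 θ :=
  ⟨⟨⟨g, h.isWeakPartial_r⟩, ⟨k, h.isWeakPartial_z⟩⟩, _, fun n => (h.test n).toL2_mem,
    h.tendsto_h1Norm⟩

theorem sub {φ' : ℕ → ℝ × ℝ → ℂ} {u' g' k' : L2Flat θ} (h : H1Approx φ u g k)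
    (h' : H1Approx φ' u' g' k') :
    H1Approx (fun n p => φ n p - φ' n p) (u - u') (g - g') (k - k') where
  test n := (h.test n).sub (h'.test n)
  tendsto := by
    have := h.tendsto.sub h'.tendsto
    simp_rw [← IsGuiTest.toL2_sub] at this
    exact this
  tendsto_r := by
    have := h.tendsto_r.sub h'.tendsto_r
    simp_rw [← IsGuiTest.toL2_sub] at this
    simp_rw [(h.test _).fderiv_sub (h'.test _)]
    exact this
  tendsto_z := by
    have := h.tendsto_z.sub h'.tendsto_z
    simp_rw [← IsGuiTest.toL2_sub] at this
    simp_rw [(h.test _).fderiv_sub (h'.test _)]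
    exact this

end H1Approx

theorem IsGuiTest.h1Approx {φ : ℝ × ℝ → ℂ} (hφ : IsGuiTest θ φ) :
    H1Approx (fun _ => φ) hφ.toL2 (hφ.fderiv_apply (1, 0)).toL2 (hφ.fderiv_apply (0, 1)).toL2 :=
  ⟨fun _ => hφ, tendsto_const_nhds, tendsto_const_nhds, tendsto_const_nhds⟩

/-- Each of the three `L²` norms inside `h1Norm` is bounded by it, so convergence in `h1Norm` splits
into three `L²` convergences. -/
theorem exists_h1Approx {u : L2Flat θ} (hu : u ∈ H10 θ) :
    ∃ φ, H1Approx φ u (weakPartial θ (1, 0) u) (weakPartial θ (0, 1) u) := by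
  obtain ⟨⟨hr, hz⟩, f, hf, ht⟩ := hu
  choose φ hφ hfφ using fun n => testClasses_eq_toL2 (hf n)
  refine ⟨φ, hφ, ?_, ?_, ?_⟩
  all_goals
    refine tendsto_iff_norm_sub_tendsto_zero.2
      (squeeze_zero (fun _ => norm_nonneg _) (fun n => ?_) ht)
    rw [h1Norm, hfφ n]
    refine Real.le_sqrt_of_sq_le ?_
    rw [(((hφ n).isWeakPartial _).sub (isWeakPartial_weakPartial hr)).weakPartial_eq,
      (((hφ n).isWeakPartial _).sub (isWeakPartial_weakPartial hz)).weakPartial_eq]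
  · nlinarith [sq_nonneg ‖((hφ n).fderiv_apply (1, 0)).toL2 - weakPartial θ (1, 0) u‖,
      sq_nonneg ‖((hφ n).fderiv_apply (0, 1)).toL2 - weakPartial θ (0, 1) u‖]
  · nlinarith [sq_nonneg ‖(hφ n).toL2 - u‖,
      sq_nonneg ‖((hφ n).fderiv_apply (0, 1)).toL2 - weakPartial θ (0, 1) u‖]
  · nlinarith [sq_nonneg ‖(hφ n).toL2 - u‖,
      sq_nonneg ‖((hφ n).fderiv_apply (1, 0)).toL2 - weakPartial θ (1, 0) u‖]

theorem H10_sub_mem {u v : L2Flat θ} (hu : u ∈ H10 θ) (hv : v ∈ H10 θ) : u - v ∈ H10 θ := by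
  obtain ⟨φ, hφ⟩ := exists_h1Approx hu
  obtain ⟨ψ, hψ⟩ := exists_h1Approx hv
  exact (hφ.sub hψ).mem_H10

/-! ### Hardy's inequality on `H₀¹` and the comparison of norms -/

/-- Fatou's lemma along an almost everywhere convergent subsequence of test functions. The lower
integral is needed here: a Bochner integral would be `0` by default if `|u|²/r²` were not
integrable. -/
theorem lintegral_hardy {u : L2Flat θ} (hu : u ∈ H10 θ) :
    ∫⁻ p, ENNReal.ofReal (‖u p‖ ^ 2 / p.1 ^ 2) ∂(flatMeasure θ) ≤
      ENNReal.ofReal (4 * ‖weakPartial θ (1, 0) u‖ ^ 2) := by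
  obtain ⟨φ, hφ⟩ := exists_h1Approx hu
  obtain ⟨ns, hns, hae⟩ := (tendstoInMeasure_of_tendsto_Lp hφ.tendsto).exists_seq_tendsto_ae
  have hae' : ∀ᵐ p ∂(flatMeasure θ), Tendsto (fun i => φ (ns i) p) atTop (𝓝 (u p)) := by
    have h2 : ∀ᵐ p ∂(flatMeasure θ), ∀ i, (hφ.test (ns i)).toL2 p = φ (ns i) p :=
      ae_all_iff.2 fun i => (hφ.test (ns i)).coeFn_toL2
    filter_upwards [hae, h2] with p h1 h2
    exact h1.congr h2
  calc ∫⁻ p, ENNReal.ofReal (‖u p‖ ^ 2 / p.1 ^ 2) ∂(flatMeasure θ)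
      = ∫⁻ p, liminf (fun i => ENNReal.ofReal (‖φ (ns i) p‖ ^ 2 / p.1 ^ 2)) atTop
          ∂(flatMeasure θ) := by
        refine lintegral_congr_ae ?_
        filter_upwards [hae'] with p hp
        exact (ENNReal.tendsto_ofReal ((hp.norm.pow 2).div_const _)).liminf_eq.symm
    _ ≤ liminf (fun i => ∫⁻ p, ENNReal.ofReal (‖φ (ns i) p‖ ^ 2 / p.1 ^ 2) ∂(flatMeasure θ))
          atTop := by
        refine lintegral_liminf_le' fun i => ?_
        exact ((hφ.test (ns i)).integrable_norm_sq_div.aestronglyMeasurable.aemeasurable).ennreal_ofReal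
    _ ≤ liminf (fun i => ENNReal.ofReal
          (4 * ‖((hφ.test (ns i)).fderiv_apply (1, 0)).toL2‖ ^ 2)) atTop := by
        refine liminf_le_liminf (.of_forall fun i => ?_)
        rw [← ofReal_integral_eq_lintegral_ofReal (hφ.test (ns i)).integrable_norm_sq_div
          (.of_forall fun p => by positivity), IsGuiTest.norm_sq_toL2]
        exact ENNReal.ofReal_le_ofReal (hφ.test (ns i)).hardy
    _ = ENNReal.ofReal (4 * ‖weakPartial θ (1, 0) u‖ ^ 2) :=
        (ENNReal.tendsto_ofReal
          (((hφ.tendsto_r.comp hns.tendsto_atTop).norm.pow 2).const_mul 4)).liminf_eq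

theorem integrable_norm_sq_div {u : L2Flat θ} (hu : u ∈ H10 θ) :
    Integrable (fun p : ℝ × ℝ => ‖u p‖ ^ 2 / p.1 ^ 2) (flatMeasure θ) := by
  refine ⟨?_, ?_⟩
  · have h1 := (Lp.aestronglyMeasurable u).norm.aemeasurable
    exact ((h1.pow_const 2).div (by fun_prop)).aestronglyMeasurable
  · rw [hasFiniteIntegral_iff_ofReal (.of_forall fun p => by positivity)]
    exact (lintegral_hardy hu).trans_lt ENNReal.ofReal_lt_top

theorem integral_hardy {u : L2Flat θ} (hu : u ∈ H10 θ) :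
    ∫ p, ‖u p‖ ^ 2 / p.1 ^ 2 ∂(flatMeasure θ) ≤ 4 * ‖weakPartial θ (1, 0) u‖ ^ 2 := by
  have h := lintegral_hardy hu
  rw [← ofReal_integral_eq_lintegral_ofReal (integrable_norm_sq_div hu)
    (.of_forall fun p => by positivity)] at h
  exact (ENNReal.ofReal_le_ofReal_iff (by positivity)).1 h

theorem flatForm_eq (ω : ℝ) (m : ℤ) {u : L2Flat θ} (hu : u ∈ H10 θ) :
    flatForm θ ω m u = ‖weakPartial θ (1, 0) u‖ ^ 2 + ‖weakPartial θ (0, 1) u‖ ^ 2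
      + (((m : ℝ) - ω) ^ 2 - 1 / 4) * ∫ p, ‖u p‖ ^ 2 / p.1 ^ 2 ∂(flatMeasure θ) := by
  rw [flatForm, norm_sq_eq_integral, norm_sq_eq_integral, ← integral_const_mul,
    ← integral_add (integrable_norm_sq _) (integrable_norm_sq _), ← integral_add
      (by exact (integrable_norm_sq _).add (integrable_norm_sq _))
      ((integrable_norm_sq_div hu).const_mul _)]
  refine integral_congr_ae (.of_forall fun p => ?_)
  simp only
  ring

/-- If `0 ≤ I ≤ 4a`, then `a + b + (γ - 1/4) I` is comparable to `a + b` for `γ > 0`. -/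
theorem hardy_form_bounds {a b I γ : ℝ} (hb : 0 ≤ b) (hI : 0 ≤ I) (hIa : I ≤ 4 * a)
    (hγ : 0 < γ) :
    min 1 (4 * γ) * (a + b) ≤ a + b + (γ - 1 / 4) * I ∧
      a + b + (γ - 1 / 4) * I ≤ (1 + 4 * γ) * (a + b) := by
  have ha : 0 ≤ a := by linarith
  constructor
  -- For `γ ≥ 1/4` the last term is nonnegative and is dropped. Otherwise `I = 4a` is the worst
  -- case, leaving `4γa + b ≥ 4γ(a + b)`.
  · rcases le_total (1 / 4) γ with h | h
    · rw [min_eq_left (by linarith)]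
      nlinarith
    · rw [min_eq_right (by linarith)]
      nlinarith
  · nlinarith

theorem norm_comparison (ω : ℝ) (m : ℤ) (hγ : 0 < ((m : ℝ) - ω) ^ 2) {u : L2Flat θ}
    (hu : u ∈ H10 θ) :
    0 ≤ flatForm θ ω m u ∧
    Real.sqrt (min 1 (4 * ((m : ℝ) - ω) ^ 2)) * h1Norm θ u ≤ flatFormNorm θ ω m u ∧
    flatFormNorm θ ω m u ≤ Real.sqrt (1 + 4 * ((m : ℝ) - ω) ^ 2) * h1Norm θ u := by
  have hI : 0 ≤ ∫ p, ‖u p‖ ^ 2 / p.1 ^ 2 ∂(flatMeasure θ) :=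
    integral_nonneg fun p => by positivity
  obtain ⟨h1, h2⟩ := hardy_form_bounds (sq_nonneg ‖weakPartial θ (0, 1) u‖) hI
    (integral_hardy hu) hγ
  rw [← flatForm_eq ω m hu] at h1 h2
  have hmin : 0 < min 1 (4 * ((m : ℝ) - ω) ^ 2) := lt_min one_pos (by linarith)
  refine ⟨le_trans (by positivity) h1, ?_, ?_⟩
  · rw [h1Norm, flatFormNorm, ← Real.sqrt_mul hmin.le]
    refine Real.sqrt_le_sqrt ?_
    -- The term `‖u‖²` enters both norms with weight one; as the lower constant is at most `1`,
    -- adding it does no harm.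
    have := mul_le_mul_of_nonneg_right (min_le_left 1 (4 * ((m : ℝ) - ω) ^ 2)) (sq_nonneg ‖u‖)
    linarith
  · rw [h1Norm, flatFormNorm, ← Real.sqrt_mul (by positivity)]
    refine Real.sqrt_le_sqrt ?_
    nlinarith [sq_nonneg ‖u‖]

/-! ### Smooth dependence of integrals on a parameter -/

theorem hasFDerivAt_slice_left {F : Type*} [NormedAddCommGroup F] [NormedSpace ℝ F]
    {f : (ℝ × ℝ) × ℝ → F} {p : ℝ × ℝ} {t : ℝ} (hf : DifferentiableAt ℝ f (p, t)) :
    HasFDerivAt (fun q => f (q, t))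
      ((fderiv ℝ f (p, t)).comp (ContinuousLinearMap.inl ℝ (ℝ × ℝ) ℝ)) p :=
  HasFDerivAt.comp (g := f) (f := fun q => (q, t)) p hf.hasFDerivAt (hasFDerivAt_prodMk_left p t)

theorem hasFDerivAt_intervalIntegral_of_contDiff {F : Type*} [NormedAddCommGroup F]
    [NormedSpace ℝ F] {f : (ℝ × ℝ) × ℝ → F} (hf : ContDiff ℝ 1 f)
    (a b : ℝ) (p : ℝ × ℝ) :
    HasFDerivAt (fun p => ∫ t in a..b, f (p, t))
      (∫ t in a..b, (fderiv ℝ f (p, t)).comp (ContinuousLinearMap.inl ℝ (ℝ × ℝ) ℝ)) p := by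
  have hcont : Continuous fun x : (ℝ × ℝ) × ℝ =>
      (fderiv ℝ f x).comp (ContinuousLinearMap.inl ℝ (ℝ × ℝ) ℝ) :=
    (hf.continuous_fderiv (by simp)).clm_comp continuous_const
  -- The dominating function is constant: the partial derivative is bounded on the compact product
  -- of a ball with the interval.
  obtain ⟨C, hC⟩ := ((isCompact_closedBall p 1).prod (isCompact_uIcc (a := a) (b := b))).bddAbove_image
    hcont.norm.continuousOn
  refine intervalIntegral.hasFDerivAt_integral_of_dominated_of_fderiv_le
    (F := fun p t => f (p, t))
    (F' := fun p t => (fderiv ℝ f (p, t)).comp (ContinuousLinearMap.inl ℝ (ℝ × ℝ) ℝ))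
    (bound := fun _ => C) (Metric.closedBall_mem_nhds p one_pos) ?_ ?_ ?_ ?_ ?_ ?_
  · exact .of_forall fun x => (hf.continuous.comp (by fun_prop)).aestronglyMeasurable
  · exact (hf.continuous.comp (by fun_prop)).intervalIntegrable _ _
  · exact (hcont.comp (by fun_prop : Continuous fun t : ℝ => (p, t))).aestronglyMeasurable
  · exact .of_forall fun t ht x hx =>
      hC ⟨(x, t), ⟨hx, Set.uIoc_subset_uIcc ht⟩, rfl⟩
  · exact intervalIntegrable_const
  · refine .of_forall fun t _ x _ => ?_
    exact hasFDerivAt_slice_left (hf.differentiable (by simp) (x, t))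

/-- The derivative of a parametric integral is again one, now with values in a space of linear maps.
The induction therefore quantifies over the target `F`, in a universe stable under passing to `ℝ × ℝ
→L[ℝ] F`. -/
theorem contDiff_intervalIntegral_nat (n : ℕ) : ∀ {F : Type} [NormedAddCommGroup F]
    [NormedSpace ℝ F] {f : (ℝ × ℝ) × ℝ → F}, ContDiff ℝ ((⊤ : ℕ∞) : WithTop ℕ∞) f → ∀ a b : ℝ,
    ContDiff ℝ n (fun p => ∫ t in a..b, f (p, t)) := by
  induction n with
  | zero =>
    intro F _ _ f hf a b
    refine contDiff_zero.2 (Differentiable.continuous (𝕜 := ℝ) fun p => ?_)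
    exact (hasFDerivAt_intervalIntegral_of_contDiff (hf.of_le (by simp)) a b p).differentiableAt
  | succ n ih =>
    intro F _ _ f hf a b
    have hd := fun p => hasFDerivAt_intervalIntegral_of_contDiff (hf.of_le (by simp)) a b p
    push_cast
    refine contDiff_succ_iff_fderiv.2 ⟨fun p => (hd p).differentiableAt, by simp, ?_⟩
    rw [funext fun p => (hd p).fderiv]
    exact ih (f := fun x => (fderiv ℝ f x).comp (ContinuousLinearMap.inl ℝ (ℝ × ℝ) ℝ))
      ((hf.fderiv_right (m := ((⊤ : ℕ∞) : WithTop ℕ∞)) (by simp)).clm_comp contDiff_const) a b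

theorem contDiff_intervalIntegral {F : Type} [NormedAddCommGroup F] [NormedSpace ℝ F]
    {f : (ℝ × ℝ) × ℝ → F} (hf : ContDiff ℝ ((⊤ : ℕ∞) : WithTop ℕ∞) f) (a b : ℝ) :
    ContDiff ℝ ((⊤ : ℕ∞) : WithTop ℕ∞) (fun p => ∫ t in a..b, f (p, t)) :=
  contDiff_infty.2 fun n => contDiff_intervalIntegral_nat n hf a b

/-! ### Angular modes -/

theorem angularMode_coe (m : ℤ) (t : ℝ) : angularMode m (t : S1) =
    ((Real.sqrt (2 * Real.pi) : ℝ) : ℂ)⁻¹ * Complex.exp (Complex.I * m * t) := by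
  rw [angularMode, fourier_coe_apply]
  congr 2
  push_cast
  have : (Real.pi : ℂ) ≠ 0 := by exact_mod_cast Real.pi_ne_zero
  field_simp

theorem continuous_angularMode (m : ℤ) : Continuous (angularMode m) :=
  continuous_const.mul (fourier m).continuous

theorem contDiff_angularMode (m : ℤ) :
    ContDiff ℝ ((⊤ : ℕ∞) : WithTop ℕ∞) (fun t : ℝ => angularMode m (t : S1)) := by
  simp_rw [angularMode_coe]
  exact contDiff_const.mul ((contDiff_const.mul Complex.ofRealCLM.contDiff).cexp)

theorem hasDerivAt_angularMode (m : ℤ) (t : ℝ) :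
    HasDerivAt (fun t : ℝ => angularMode m (t : S1))
      (Complex.I * m * angularMode m (t : S1)) t := by
  simp_rw [angularMode_coe]
  have h : HasDerivAt (fun t : ℝ => Complex.I * m * (t : ℂ)) (Complex.I * m) t := by
    simpa using (Complex.ofRealCLM.hasDerivAt (x := t)).const_mul (Complex.I * (m : ℂ))
  refine (h.cexp.const_mul (((Real.sqrt (2 * Real.pi) : ℝ) : ℂ)⁻¹)).congr_deriv ?_
  ring

theorem norm_angularMode_sq (m : ℤ) (φ : S1) : ‖angularMode m φ‖ ^ 2 = (2 * Real.pi)⁻¹ := by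
  rw [angularMode, norm_mul, mul_pow, norm_inv, Complex.norm_real, Real.norm_eq_abs, inv_pow,
    sq_abs, Real.sq_sqrt Real.two_pi_pos.le]
  rw [fourier_apply, Circle.norm_coe, one_pow, mul_one]

/-! ### Test functions on the layer -/

/-- The derivative of `v` in the meridian direction `e`. -/
def layerD (e : ℝ × ℝ) (v : (ℝ × ℝ) × S1 → ℂ) (x : (ℝ × ℝ) × S1) : ℂ :=
  fderiv ℝ (fun p => v (p, x.2)) x.1 e

/-- The covering `ℝ² × ℝ → ℝ² × 𝕊¹` is a product of open quotient maps, hence a quotient map. -/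
theorem continuous_of_lift {X : Type*} [TopologicalSpace X] {v : (ℝ × ℝ) × S1 → X}
    (h : Continuous fun x : (ℝ × ℝ) × ℝ => v (x.1, (x.2 : S1))) : Continuous v := by
  have hq : IsOpenQuotientMap (Prod.map (id : ℝ × ℝ → ℝ × ℝ) (fun t : ℝ => (t : S1))) :=
    IsOpenQuotientMap.id.prodMap QuotientAddGroup.isOpenQuotientMap_mk
  exact hq.isQuotientMap.continuous_iff.2 h

theorem eventually_eq_zero_of_notMem_tsupport {v : (ℝ × ℝ) × S1 → ℂ} {p : ℝ × ℝ} {t : ℝ}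
    (h : (p, (t : S1)) ∉ tsupport v) :
    (fun x : (ℝ × ℝ) × ℝ => v (x.1, (x.2 : S1))) =ᶠ[𝓝 (p, t)] 0 := by
  have hc : Continuous fun x : (ℝ × ℝ) × ℝ => (x.1, (x.2 : S1)) :=
    continuous_fst.prodMk ((AddCircle.continuous_mk' _).comp continuous_snd)
  exact (hc.tendsto (p, t)).eventually (notMem_tsupport_iff_eventuallyEq.1 h)

namespace IsLayerTest

variable {v w : (ℝ × ℝ) × S1 → ℂ}

theorem continuous (hv : IsLayerTest θ v) : Continuous v :=
  continuous_of_lift hv.smooth.continuous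

theorem memLp (hv : IsLayerTest θ v) : MemLp v 2 (layerMeasure θ) :=
  hv.continuous.memLp_of_hasCompactSupport hv.compact

theorem integrable_norm_sq (hv : IsLayerTest θ v) :
    Integrable (fun x => ‖v x‖ ^ 2) (layerMeasure θ) :=
  hv.memLp.integrable_norm_pow (by simp)

/-- Reduces the test property of derivatives and products to smoothness of the lift and vanishing
off the old support. -/
theorem of_tsupport_subset (hv : IsLayerTest θ v)
    (hw : ContDiff ℝ ((⊤ : ℕ∞) : WithTop ℕ∞) (fun x : (ℝ × ℝ) × ℝ => w (x.1, (x.2 : S1))))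
    (h : ∀ x ∉ tsupport v, w x = 0) : IsLayerTest θ w := by
  have hs : tsupport w ⊆ tsupport v :=
    closure_minimal (fun x hx => by_contra fun hx' => hx (h x hx')) (isClosed_tsupport v)
  exact ⟨hw, hv.compact.mono' ((subset_tsupport w).trans hs), hs.trans hv.support⟩

theorem differentiable_lift (hv : IsLayerTest θ v) :
    Differentiable ℝ (fun x : (ℝ × ℝ) × ℝ => v (x.1, (x.2 : S1))) :=
  hv.smooth.differentiable (by simp)

theorem hasFDerivAt_slice (hv : IsLayerTest θ v) (p : ℝ × ℝ) (t : ℝ) :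
    HasFDerivAt (fun p => v (p, (t : S1)))
      ((fderiv ℝ (fun x : (ℝ × ℝ) × ℝ => v (x.1, (x.2 : S1))) (p, t)).comp
        (ContinuousLinearMap.inl ℝ (ℝ × ℝ) ℝ)) p :=
  hasFDerivAt_slice_left (hv.differentiable_lift (p, t))

theorem layerD_coe (hv : IsLayerTest θ v) (e p : ℝ × ℝ) (t : ℝ) :
    ConicalLayer.layerD e v (p, (t : S1)) =
      fderiv ℝ (fun x : (ℝ × ℝ) × ℝ => v (x.1, (x.2 : S1))) (p, t) (e, 0) := by
  rw [ConicalLayer.layerD, (hv.hasFDerivAt_slice p t).fderiv]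
  simp

theorem layerDphi_coe (hv : IsLayerTest θ v) (p : ℝ × ℝ) (t : ℝ) :
    ConicalLayer.layerDphi v (p, (t : S1)) =
      fderiv ℝ (fun x : (ℝ × ℝ) × ℝ => v (x.1, (x.2 : S1))) (p, t) (0, 1) := by
  have h1 : HasDerivAt (fun s : ℝ => (p, t + s)) ((0 : ℝ × ℝ), (1 : ℝ)) 0 :=
    (hasDerivAt_const _ _).prodMk ((hasDerivAt_id (0 : ℝ)).const_add t)
  have h2 := (hv.differentiable_lift (p, t + 0)).hasFDerivAt.comp_hasDerivAt (0 : ℝ) h1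
  rw [add_zero] at h2
  exact h2.deriv

theorem hasDerivAt_angular (hv : IsLayerTest θ v) (p : ℝ × ℝ) (t : ℝ) :
    HasDerivAt (fun s : ℝ => v (p, (s : S1))) (ConicalLayer.layerDphi v (p, (t : S1))) t := by
  rw [hv.layerDphi_coe]
  exact (hv.differentiable_lift (p, t)).hasFDerivAt.comp_hasDerivAt t
    ((hasDerivAt_const t p).prodMk (hasDerivAt_id t))

theorem layerD (hv : IsLayerTest θ v) (e : ℝ × ℝ) : IsLayerTest θ (ConicalLayer.layerD e v) := by
  refine hv.of_tsupport_subset ?_ fun x hx => ?_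
  · simp_rw [hv.layerD_coe e]
    exact (hv.smooth.fderiv_right (m := ((⊤ : ℕ∞) : WithTop ℕ∞)) (by simp)).clm_apply
      contDiff_const
  · obtain ⟨p, φ⟩ := x
    induction φ using QuotientAddGroup.induction_on with
    | H t =>
      rw [hv.layerD_coe, (eventually_eq_zero_of_notMem_tsupport hx).fderiv_eq]
      simp

theorem layerDphi (hv : IsLayerTest θ v) : IsLayerTest θ (ConicalLayer.layerDphi v) := by
  refine hv.of_tsupport_subset ?_ fun x hx => ?_
  · simp_rw [hv.layerDphi_coe]
    exact (hv.smooth.fderiv_right (m := ((⊤ : ℕ∞) : WithTop ℕ∞)) (by simp)).clm_apply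
      contDiff_const
  · obtain ⟨p, φ⟩ := x
    induction φ using QuotientAddGroup.induction_on with
    | H t =>
      rw [hv.layerDphi_coe, (eventually_eq_zero_of_notMem_tsupport hx).fderiv_eq]
      simp

theorem sub (hv : IsLayerTest θ v) (hw : IsLayerTest θ w) :
    IsLayerTest θ (fun x => v x - w x) where
  smooth := hv.smooth.sub hw.smooth
  compact := hv.compact.sub hw.compact
  support := (tsupport_sub v w).trans (Set.union_subset hv.support hw.support)

/-- Multiplication by a function of `(r, z)` that is smooth where `r > 0` preserves test
functions. -/
theorem mul_left {h : ℝ × ℝ → ℂ} (hv : IsLayerTest θ v)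
    (hh : ∀ p : ℝ × ℝ, 0 < p.1 → ContDiffAt ℝ ((⊤ : ℕ∞) : WithTop ℕ∞) h p) :
    IsLayerTest θ (fun x => h x.1 * v x) := by
  refine hv.of_tsupport_subset (contDiff_iff_contDiffAt.2 fun x => ?_) fun x hx => by
    rw [image_eq_zero_of_notMem_tsupport hx, mul_zero]
  obtain ⟨p, t⟩ := x
  by_cases hp : (p, (t : S1)) ∈ tsupport v
  · exact ((hh p (hv.support hp).1.1).comp (p, t) contDiffAt_fst).mul hv.smooth.contDiffAt
  · refine (contDiffAt_const (c := (0 : ℂ))).congr_of_eventuallyEq ?_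
    filter_upwards [eventually_eq_zero_of_notMem_tsupport hp] with q hq
    simp only [Pi.zero_apply] at hq
    rw [hq, mul_zero]

theorem const_mul (hv : IsLayerTest θ v) (c : ℂ) : IsLayerTest θ (fun x => c * v x) :=
  hv.mul_left (h := fun _ => c) fun _ _ => contDiffAt_const

end IsLayerTest

/-! ### Angular projections of test functions -/

theorem angularProj_eq_intervalIntegral (m : ℤ) (v : (ℝ × ℝ) × S1 → ℂ) (p : ℝ × ℝ) :
    angularProj m v p =
      ∫ t in (0 : ℝ)..2 * Real.pi, v (p, (t : S1)) * conj (angularMode m (t : S1)) := by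
  have := AddCircle.intervalIntegral_preimage (2 * Real.pi) 0
    (fun φ => v (p, φ) * conj (angularMode m φ))
  rw [zero_add] at this
  exact this.symm

namespace IsLayerTest

variable {v w : (ℝ × ℝ) × S1 → ℂ}

theorem contDiff_mul_mode (hv : IsLayerTest θ v) (m : ℤ) :
    ContDiff ℝ ((⊤ : ℕ∞) : WithTop ℕ∞) (fun x : (ℝ × ℝ) × ℝ =>
      v (x.1, (x.2 : S1)) * conj (angularMode m (x.2 : S1))) :=
  hv.smooth.mul (Complex.conjCLE.contDiff.comp ((contDiff_angularMode m).comp contDiff_snd))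

/-- The support lies in the meridian shadow of `tsupport v`, which is compact and contained in the
domain; smoothness is differentiation under the integral. -/
theorem isGuiTest_angularProj (hv : IsLayerTest θ v) (m : ℤ) :
    IsGuiTest θ (angularProj m v) := by
  have hK : IsCompact (Prod.fst '' tsupport v) := hv.compact.isCompact.image continuous_fst
  have h0 : ∀ p ∉ Prod.fst '' tsupport v, angularProj m v p = 0 := fun p hp => by
    have : ∀ φ : S1, v (p, φ) = 0 := fun φ =>
      image_eq_zero_of_notMem_tsupport fun h => hp ⟨_, h, rfl⟩
    simp [angularProj, this]
  refine ⟨?_, HasCompactSupport.intro hK h0, ?_⟩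
  · rw [funext (angularProj_eq_intervalIntegral m v)]
    exact contDiff_intervalIntegral (hv.contDiff_mul_mode m) 0 (2 * Real.pi)
  · have hs : Function.support (angularProj m v) ⊆ Prod.fst '' tsupport v :=
      fun p hp => by_contra fun h => hp (h0 p h)
    refine (closure_minimal hs hK.isClosed).trans ?_
    rintro _ ⟨x, hx, rfl⟩
    exact (hv.support hx).1

theorem fderiv_angularProj (hv : IsLayerTest θ v) (m : ℤ) (p e : ℝ × ℝ) :
    fderiv ℝ (angularProj m v) p e = angularProj m (ConicalLayer.layerD e v) p := by
  have h := hasFDerivAt_intervalIntegral_of_contDiff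
    ((hv.contDiff_mul_mode m).of_le (by simp)) 0 (2 * Real.pi) p
  have hcont : Continuous fun t : ℝ => (fderiv ℝ (fun x : (ℝ × ℝ) × ℝ =>
      v (x.1, (x.2 : S1)) * conj (angularMode m (x.2 : S1))) (p, t)).comp
        (ContinuousLinearMap.inl ℝ (ℝ × ℝ) ℝ) :=
    (((hv.contDiff_mul_mode m).continuous_fderiv (by simp)).comp (by fun_prop)).clm_comp
      continuous_const
  rw [funext (angularProj_eq_intervalIntegral m v), h.fderiv, angularProj_eq_intervalIntegral,
    ContinuousLinearMap.intervalIntegral_apply (hcont.intervalIntegrable _ _)]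
  refine intervalIntegral.integral_congr fun t _ => ?_
  have h1 := (hasFDerivAt_slice_left
    ((hv.contDiff_mul_mode m).differentiable (by simp) (p, t))).unique
    ((hv.hasFDerivAt_slice p t).mul_const (conj (angularMode m (t : S1))))
  have h2 := congrArg (fun L : (ℝ × ℝ) →L[ℝ] ℂ => L e) h1
  refine Eq.trans h2 ?_
  simp only [hv.layerD_coe]
  simp [mul_comm]

/-- Integration by parts on the circle: the derivative of `v` times the conjugate mode integrates to
zero over `[0, 2π]`, since the endpoints are the same point of `𝕊¹`. -/
theorem angularProj_layerDphi (hv : IsLayerTest θ v) (m : ℤ) (p : ℝ × ℝ) :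
    angularProj m (ConicalLayer.layerDphi v) p = Complex.I * m * angularProj m v p := by
  have hint : ∀ {u : (ℝ × ℝ) × S1 → ℂ}, IsLayerTest θ u → IntervalIntegrable
      (fun t : ℝ => u (p, (t : S1)) * conj (angularMode m (t : S1))) volume 0 (2 * Real.pi) :=
    fun hu => ((hu.contDiff_mul_mode m).continuous.comp
      (by fun_prop : Continuous fun t : ℝ => (p, t))).intervalIntegrable _ _
  have i1 := hint hv.layerDphi
  have i2 := hint hv
  rw [angularProj_eq_intervalIntegral, angularProj_eq_intervalIntegral,
    ← intervalIntegral.integral_const_mul, ← sub_eq_zero, ← intervalIntegral.integral_sub]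
  · have hd : ∀ t : ℝ, HasDerivAt (fun t : ℝ => v (p, (t : S1)) * conj (angularMode m (t : S1)))
        (ConicalLayer.layerDphi v (p, (t : S1)) * conj (angularMode m (t : S1)) -
          Complex.I * m * (v (p, (t : S1)) * conj (angularMode m (t : S1)))) t := fun t => by
      refine ((hv.hasDerivAt_angular p t).mul (hasDerivAt_angularMode m t).star).congr_deriv ?_
      simp
      ring
    rw [intervalIntegral.integral_eq_sub_of_hasDerivAt (fun t _ => hd t)]
    · have : ((2 * Real.pi : ℝ) : S1) = ((0 : ℝ) : S1) := by simp
      rw [this, sub_self]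
    · exact (i1.sub (i2.const_mul _))
  · exact i1
  · exact i2.const_mul _

end IsLayerTest

/-! ### Energies on the meridian domain -/

/-- The radial energy `∫ (|∂_r w|² + |∂_z w|² + c |w|² / r²) r dr dz`. -/
def radialEnergy (θ c : ℝ) (w : ℝ × ℝ → ℂ) : ℝ :=
  ∫ p, (‖fderiv ℝ w p (1, 0)‖ ^ 2 + ‖fderiv ℝ w p (0, 1)‖ ^ 2
    + c * (‖w p‖ ^ 2 / p.1 ^ 2)) ∂(radialMeasure θ)

theorem integral_radialMeasure (f : ℝ × ℝ → ℝ) :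
    ∫ p, f p ∂(radialMeasure θ) = ∫ p, p.1 * f p ∂(flatMeasure θ) := by
  rw [radialMeasure, integral_withDensity_eq_integral_toReal_smul (by fun_prop) (by simp)]
  refine integral_congr_ae ?_
  filter_upwards [ae_fst_pos θ] with p hp
  rw [ENNReal.toReal_ofReal hp.le, smul_eq_mul]

theorem contDiffAt_sqrt_fst {p : ℝ × ℝ} (hp : 0 < p.1) :
    ContDiffAt ℝ ((⊤ : ℕ∞) : WithTop ℕ∞) (fun p : ℝ × ℝ => ((Real.sqrt p.1 : ℝ) : ℂ)) p :=
  Complex.ofRealCLM.contDiff.contDiffAt.comp p (contDiffAt_fst.sqrt hp.ne')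

theorem contDiffAt_sqrt_fst_inv {p : ℝ × ℝ} (hp : 0 < p.1) :
    ContDiffAt ℝ ((⊤ : ℕ∞) : WithTop ℕ∞) (fun p : ℝ × ℝ => (((Real.sqrt p.1)⁻¹ : ℝ) : ℂ)) p :=
  Complex.ofRealCLM.contDiff.contDiffAt.comp p
    ((contDiffAt_fst.sqrt hp.ne').inv (Real.sqrt_pos.2 hp).ne')

namespace IsGuiTest

variable {φ w : ℝ × ℝ → ℂ}

theorem sqrt_mul (hw : IsGuiTest θ w) :
    IsGuiTest θ (fun p => ((Real.sqrt p.1 : ℝ) : ℂ) * w p) :=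
  hw.mul_left fun _ => contDiffAt_sqrt_fst

theorem sqrt_inv_mul (hw : IsGuiTest θ w) :
    IsGuiTest θ (fun p => (((Real.sqrt p.1)⁻¹ : ℝ) : ℂ) * w p) :=
  hw.mul_left fun _ => contDiffAt_sqrt_fst_inv

/-- The identity holds at every point, also where `√r = 0`, because `φ` vanishes off the domain. -/
theorem sqrt_mul_sqrt_inv_mul (hφ : IsGuiTest θ φ) :
    (fun p : ℝ × ℝ => ((Real.sqrt p.1 : ℝ) : ℂ) * ((((Real.sqrt p.1)⁻¹ : ℝ) : ℂ) * φ p)) = φ := by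
  funext p
  by_cases hp : p ∈ Gui θ
  · have : ((Real.sqrt p.1 : ℝ) : ℂ) ≠ 0 :=
      Complex.ofReal_ne_zero.2 (Real.sqrt_pos.2 hp.1).ne'
    push_cast
    field_simp
  · simp [hφ.eq_zero_of_notMem hp]

theorem hasFDerivAt_sqrt_mul (hw : IsGuiTest θ w) {p : ℝ × ℝ} (hp : 0 < p.1) :
    HasFDerivAt (fun p : ℝ × ℝ => ((Real.sqrt p.1 : ℝ) : ℂ) * w p)
      (((Real.sqrt p.1 : ℝ) : ℂ) • fderiv ℝ w p + w p • (Complex.ofRealCLM.comp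
        ((1 / (2 * Real.sqrt p.1)) • ContinuousLinearMap.fst ℝ ℝ ℝ))) p :=
  HasFDerivAt.fun_mul (Complex.ofRealCLM.hasFDerivAt.comp p
    ((hasFDerivAt_fst (𝕜 := ℝ) (p := p)).sqrt hp.ne')) (hw.differentiable p).hasFDerivAt

/-- The product rule produces the extra term `w / (2√r) = (√r w) / (2r)`, which is exactly what the
ground state representation subtracts. -/
theorem fderiv_sqrt_mul_r (hw : IsGuiTest θ w) {p : ℝ × ℝ} (hp : 0 < p.1) :
    fderiv ℝ (fun p : ℝ × ℝ => ((Real.sqrt p.1 : ℝ) : ℂ) * w p) p (1, 0) -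
      ((p.1⁻¹ : ℝ) : ℂ) * (((Real.sqrt p.1 : ℝ) : ℂ) * w p) / 2 =
        ((Real.sqrt p.1 : ℝ) : ℂ) * fderiv ℝ w p (1, 0) := by
  rw [(hw.hasFDerivAt_sqrt_mul hp).fderiv]
  have h0 : ((Real.sqrt p.1 : ℝ) : ℂ) ≠ 0 :=
    Complex.ofReal_ne_zero.2 (Real.sqrt_pos.2 hp).ne'
  have h1 : ((p.1⁻¹ : ℝ) : ℂ) = (((Real.sqrt p.1 : ℝ) : ℂ) ^ 2)⁻¹ := by
    rw [← Complex.ofReal_pow, Real.sq_sqrt hp.le, Complex.ofReal_inv]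
  rw [h1]
  simp
  field_simp
  ring

theorem fderiv_sqrt_mul_z (hw : IsGuiTest θ w) {p : ℝ × ℝ} (hp : 0 < p.1) :
    fderiv ℝ (fun p : ℝ × ℝ => ((Real.sqrt p.1 : ℝ) : ℂ) * w p) p (0, 1) =
        ((Real.sqrt p.1 : ℝ) : ℂ) * fderiv ℝ w p (0, 1) := by
  rw [(hw.hasFDerivAt_sqrt_mul hp).fderiv]
  simp

/-- The substitution `φ = √r w` turns the radial energy into the flat Hardy form. -/
theorem radialEnergy_eq (hw : IsGuiTest θ w) (c : ℝ) :
    radialEnergy θ c w = ‖(hw.sqrt_mul.fderiv_apply (1, 0)).toL2‖ ^ 2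
      + ‖(hw.sqrt_mul.fderiv_apply (0, 1)).toL2‖ ^ 2
      + (c - 1 / 4) * ∫ p, ‖((Real.sqrt p.1 : ℝ) : ℂ) * w p‖ ^ 2 / p.1 ^ 2 ∂(flatMeasure θ) := by
  have hg := hw.sqrt_mul.integral_ground_state
  have i1 : Integrable (fun p => ‖fderiv ℝ (fun p : ℝ × ℝ => ((Real.sqrt p.1 : ℝ) : ℂ) * w p) p
      (1, 0) - ((p.1⁻¹ : ℝ) : ℂ) * (((Real.sqrt p.1 : ℝ) : ℂ) * w p) / 2‖ ^ 2)
      (flatMeasure θ) := by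
    have := ((hw.sqrt_mul.fderiv_apply (1, 0)).sub
      (hw.sqrt_mul.inv_fst_mul.mul_left (h := fun _ => 2⁻¹)
        fun _ _ => contDiffAt_const)).integrable_norm_sq
    refine this.congr (.of_forall fun p => ?_)
    simp only
    congr 3
    ring
  have i2 := (hw.sqrt_mul.fderiv_apply (0, 1)).integrable_norm_sq
  have i3 := hw.sqrt_mul.integrable_norm_sq_div
  have e : radialEnergy θ c w = ∫ p, (‖fderiv ℝ (fun p : ℝ × ℝ => ((Real.sqrt p.1 : ℝ) : ℂ) * w p)
      p (1, 0) - ((p.1⁻¹ : ℝ) : ℂ) * (((Real.sqrt p.1 : ℝ) : ℂ) * w p) / 2‖ ^ 2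
      + ‖fderiv ℝ (fun p : ℝ × ℝ => ((Real.sqrt p.1 : ℝ) : ℂ) * w p) p (0, 1)‖ ^ 2
      + c * (‖((Real.sqrt p.1 : ℝ) : ℂ) * w p‖ ^ 2 / p.1 ^ 2)) ∂(flatMeasure θ) := by
    rw [radialEnergy, integral_radialMeasure]
    refine integral_congr_ae ?_
    filter_upwards [ae_fst_pos θ] with p hp
    rw [hw.fderiv_sqrt_mul_r hp, hw.fderiv_sqrt_mul_z hp]
    simp only [norm_mul, mul_pow, Complex.norm_real, Real.norm_eq_abs, sq_abs,
      Real.sq_sqrt hp.le]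
    ring
  rw [e, integral_add (by exact i1.add i2) (i3.const_mul c), integral_add i1 i2,
    integral_const_mul, hg, norm_sq_toL2, norm_sq_toL2]
  ring

/-- Hardy's inequality for `√r w`. The lower bound turns form-Cauchy sequences into `H¹`-Cauchy
ones, the upper bound does the converse. -/
theorem radialEnergy_bounds (hw : IsGuiTest θ w) {c : ℝ} (hc : 0 < c) :
    min 1 (4 * c) * (‖(hw.sqrt_mul.fderiv_apply (1, 0)).toL2‖ ^ 2
      + ‖(hw.sqrt_mul.fderiv_apply (0, 1)).toL2‖ ^ 2) ≤ radialEnergy θ c w ∧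
    radialEnergy θ c w ≤ (1 + 4 * c) * (‖(hw.sqrt_mul.fderiv_apply (1, 0)).toL2‖ ^ 2
      + ‖(hw.sqrt_mul.fderiv_apply (0, 1)).toL2‖ ^ 2) := by
  rw [hw.radialEnergy_eq]
  refine hardy_form_bounds (sq_nonneg _) (integral_nonneg fun p => by positivity) ?_ hc
  rw [norm_sq_toL2]
  exact hw.sqrt_mul.hardy

theorem integrable_norm_sq_radial (hw : IsGuiTest θ w) :
    Integrable (fun p => ‖w p‖ ^ 2) (radialMeasure θ) :=
  (hw.smooth.continuous.memLp_of_hasCompactSupport hw.compact :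
    MemLp w 2 (radialMeasure θ)).integrable_norm_pow (by simp)

theorem integrable_radialEnergy (hw : IsGuiTest θ w) (c : ℝ) :
    Integrable (fun p : ℝ × ℝ => ‖fderiv ℝ w p (1, 0)‖ ^ 2 + ‖fderiv ℝ w p (0, 1)‖ ^ 2
      + c * (‖w p‖ ^ 2 / p.1 ^ 2)) (radialMeasure θ) := by
  refine ((hw.fderiv_apply (1, 0)).integrable_norm_sq_radial.add
    (hw.fderiv_apply (0, 1)).integrable_norm_sq_radial).add (Integrable.const_mul ?_ c)
  refine hw.inv_fst_mul.integrable_norm_sq_radial.congr (.of_forall fun p => ?_)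
  simp only [norm_mul, mul_pow, Complex.norm_real, norm_inv, Real.norm_eq_abs, inv_pow, sq_abs]
  ring

/-! ### Test functions with a single angular mode -/

theorem tensor (hw : IsGuiTest θ w) (m : ℤ) :
    IsLayerTest θ (fun x => w x.1 * angularMode m x.2) := by
  have h0 : ∀ x : (ℝ × ℝ) × S1, x ∉ tsupport w ×ˢ Set.univ →
      w x.1 * angularMode m x.2 = 0 := fun x hx => by
    rw [image_eq_zero_of_notMem_tsupport fun h => hx ⟨h, trivial⟩, zero_mul]
  have hs : Function.support (fun x : (ℝ × ℝ) × S1 => w x.1 * angularMode m x.2) ⊆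
      tsupport w ×ˢ Set.univ := fun x hx => by_contra fun h => hx (h0 x h)
  refine ⟨?_, HasCompactSupport.intro (hw.compact.isCompact.prod isCompact_univ) h0, ?_⟩
  · exact (hw.smooth.comp contDiff_fst).mul ((contDiff_angularMode m).comp contDiff_snd)
  · exact (closure_minimal hs ((isClosed_tsupport w).prod isClosed_univ)).trans
      (Set.prod_mono_left hw.support)

theorem layerD_tensor (hw : IsGuiTest θ w) (m : ℤ) (e : ℝ × ℝ) (x : (ℝ × ℝ) × S1) :
    layerD e (fun x => w x.1 * angularMode m x.2) x =
      fderiv ℝ w x.1 e * angularMode m x.2 := by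
  rw [layerD, ((hw.differentiable x.1).hasFDerivAt.mul_const (angularMode m x.2)).fderiv]
  simp [mul_comm]

theorem layerDphi_tensor (m : ℤ) (x : (ℝ × ℝ) × S1) :
    layerDphi (fun x => w x.1 * angularMode m x.2) x =
      Complex.I * m * (w x.1 * angularMode m x.2) := by
  obtain ⟨p, φ⟩ := x
  induction φ using QuotientAddGroup.induction_on with
  | H t =>
    have h := ((hasDerivAt_angularMode m (t + 0)).comp_const_add t 0).const_mul (w p)
    rw [add_zero] at h
    refine Eq.trans h.deriv ?_
    ring

/-- On the mode, `i∂_φ - ω` is multiplication by `-(m + ω)`, and `|v_m|² = 1/(2π)` cancels the mass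
`2π` of the circle. -/
theorem layerForm_tensor (hw : IsGuiTest θ w) (ω : ℝ) (m : ℤ) :
    layerForm θ ω (fun x => w x.1 * angularMode m x.2) =
      radialEnergy θ (((m : ℝ) + ω) ^ 2) w := by
  have e : ∀ x : (ℝ × ℝ) × S1,
      ‖layerDr (fun x => w x.1 * angularMode m x.2) x‖ ^ 2
        + ‖layerDz (fun x => w x.1 * angularMode m x.2) x‖ ^ 2
        + ‖Complex.I * layerDphi (fun x => w x.1 * angularMode m x.2) x
          - (ω : ℂ) * (w x.1 * angularMode m x.2)‖ ^ 2 / x.1.1 ^ 2 =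
      (2 * Real.pi)⁻¹ * (‖fderiv ℝ w x.1 (1, 0)‖ ^ 2 + ‖fderiv ℝ w x.1 (0, 1)‖ ^ 2
        + ((m : ℝ) + ω) ^ 2 * (‖w x.1‖ ^ 2 / x.1.1 ^ 2)) := fun x => by
    have h1 : layerDr (fun x => w x.1 * angularMode m x.2) x = _ := hw.layerD_tensor m (1, 0) x
    have h2 : layerDz (fun x => w x.1 * angularMode m x.2) x = _ := hw.layerD_tensor m (0, 1) x
    have h3 : Complex.I * (Complex.I * m * (w x.1 * angularMode m x.2))
        - (ω : ℂ) * (w x.1 * angularMode m x.2) =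
        ((-((m : ℝ) + ω) : ℝ) : ℂ) * (w x.1 * angularMode m x.2) := by
      push_cast
      linear_combination (m * (w x.1 * angularMode m x.2)) * Complex.I_mul_I
    rw [h1, h2, layerDphi_tensor, h3]
    simp only [norm_mul, mul_pow, norm_angularMode_sq, Complex.norm_real, Real.norm_eq_abs,
      sq_abs]
    ring
  rw [layerForm]
  simp_rw [e]
  rw [layerMeasure, integral_fun_fst (fun p : ℝ × ℝ => (2 * Real.pi)⁻¹ *
    (‖fderiv ℝ w p (1, 0)‖ ^ 2 + ‖fderiv ℝ w p (0, 1)‖ ^ 2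
        + ((m : ℝ) + ω) ^ 2 * (‖w p‖ ^ 2 / p.1 ^ 2))), integral_const_mul, radialEnergy]
  have hv : (volume : Measure S1).real Set.univ = 2 * Real.pi := by
    rw [Measure.real, AddCircle.measure_univ, ENNReal.toReal_ofReal Real.two_pi_pos.le]
  rw [hv, smul_eq_mul, ← mul_assoc, mul_inv_cancel₀ Real.two_pi_pos.ne', one_mul]

end IsGuiTest

/-! ### Bessel's inequality for one angular mode -/

theorem lintegral_norm_angularMode_sq (m : ℤ) : ∫⁻ φ : S1, ‖angularMode m φ‖ₑ ^ (2 : ℝ) = 1 := by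
  have e : ∀ φ : S1, ‖angularMode m φ‖ₑ ^ (2 : ℝ) = ENNReal.ofReal (2 * Real.pi)⁻¹ := fun φ => by
    rw [← norm_angularMode_sq m φ, ENNReal.ofReal_pow (norm_nonneg _), ofReal_norm]
    norm_cast
  simp_rw [e]
  rw [lintegral_const, AddCircle.measure_univ, ← ENNReal.ofReal_mul (by positivity),
    inv_mul_cancel₀ Real.two_pi_pos.ne', ENNReal.ofReal_one]

/-- Cauchy–Schwarz against the unit vector `v_m`. With extended nonnegative values, measurability of
the slice is enough. -/
theorem enorm_angularProj_sq_le (m : ℤ) (f : (ℝ × ℝ) × S1 → ℂ) (p : ℝ × ℝ)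
    (hf : AEStronglyMeasurable (fun φ => f (p, φ)) (volume : Measure S1)) :
    ‖angularProj m f p‖ₑ ^ (2 : ℝ) ≤ ∫⁻ φ : S1, ‖f (p, φ)‖ₑ ^ (2 : ℝ) := by
  have h1 : ‖angularProj m f p‖ₑ ≤ ∫⁻ φ : S1, ‖f (p, φ)‖ₑ * ‖angularMode m φ‖ₑ := by
    refine (enorm_integral_le_lintegral_enorm _).trans (le_of_eq ?_)
    refine lintegral_congr fun φ => ?_
    rw [enorm_mul, RCLike.enorm_conj]
  have h2 := ENNReal.lintegral_mul_le_Lp_mul_Lq (volume : Measure S1)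
    (Real.HolderConjugate.two_two) hf.enorm (continuous_angularMode m).enorm.aemeasurable
  rw [lintegral_norm_angularMode_sq, ENNReal.one_rpow, mul_one] at h2
  refine (ENNReal.rpow_le_rpow (h1.trans h2) (by norm_num)).trans (le_of_eq ?_)
  rw [← ENNReal.rpow_mul]
  norm_num

theorem norm_angularProj_sq_le (m : ℤ) {f : (ℝ × ℝ) × S1 → ℂ} (hf : Continuous f) (p : ℝ × ℝ) :
    ‖angularProj m f p‖ ^ 2 ≤ ∫ φ : S1, ‖f (p, φ)‖ ^ 2 := by
  have hc : Continuous fun φ : S1 => f (p, φ) := by fun_prop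
  have h := enorm_angularProj_sq_le m f p hc.aestronglyMeasurable
  have hi : Integrable (fun φ : S1 => ‖f (p, φ)‖ ^ 2) :=
    (hc.norm.pow 2).integrable_of_hasCompactSupport (HasCompactSupport.of_compactSpace _)
  have e : ∀ z : ℂ, ‖z‖ₑ ^ (2 : ℝ) = ENNReal.ofReal (‖z‖ ^ 2) := fun z => by
    rw [ENNReal.ofReal_pow (norm_nonneg _), ofReal_norm]
    norm_cast
  simp_rw [e] at h
  rw [← ofReal_integral_eq_lintegral_ofReal hi (.of_forall fun _ => by positivity)] at h
  exact (ENNReal.ofReal_le_ofReal_iff (integral_nonneg fun _ => by positivity)).1 h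

namespace IsLayerTest

variable {v : (ℝ × ℝ) × S1 → ℂ}

theorem integrable_mul_mode (hv : IsLayerTest θ v) (m : ℤ) (p : ℝ × ℝ) :
    Integrable (fun φ : S1 => v (p, φ) * conj (angularMode m φ)) :=
  ((hv.continuous.comp (by fun_prop : Continuous fun φ : S1 => (p, φ))).mul
    (continuous_angularMode m).star).integrable_of_hasCompactSupport
      (HasCompactSupport.of_compactSpace _)

/-- Bessel's inequality is applied at each `p` to `∂_r v`, `∂_z v` and `(i∂_φ - ω)v`, whose
projections are the two derivatives of the projection and its multiple by `-(m + ω)`. Fubini then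
integrates over the meridian. -/
theorem radialEnergy_angularProj_le (hv : IsLayerTest θ v) (ω : ℝ) (m : ℤ) :
    radialEnergy θ (((m : ℝ) + ω) ^ 2) (angularProj m v) ≤ layerForm θ ω v := by
  have hK : IsLayerTest θ (fun x => Complex.I * ConicalLayer.layerDphi v x - (ω : ℂ) * v x) :=
    (hv.layerDphi.const_mul _).sub (hv.const_mul _)
  have hKp : ∀ p, angularProj m (fun x => Complex.I * ConicalLayer.layerDphi v x
      - (ω : ℂ) * v x) p = ((-((m : ℝ) + ω) : ℝ) : ℂ) * angularProj m v p := fun p => by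
    have : angularProj m (fun x => Complex.I * ConicalLayer.layerDphi v x - (ω : ℂ) * v x) p =
        Complex.I * angularProj m (ConicalLayer.layerDphi v) p - ω * angularProj m v p := by
      simp only [angularProj]
      rw [← integral_const_mul, ← integral_const_mul,
        ← integral_sub ((hv.layerDphi.integrable_mul_mode m p).const_mul _)
          ((hv.integrable_mul_mode m p).const_mul _)]
      congr 1 with φ
      ring
    rw [this, hv.angularProj_layerDphi]
    push_cast
    linear_combination (m * angularProj m v p) * Complex.I_mul_I
  have hdiv : ∀ x : (ℝ × ℝ) × S1, ‖((x.1.1⁻¹ : ℝ) : ℂ) *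
      (Complex.I * ConicalLayer.layerDphi v x - (ω : ℂ) * v x)‖ ^ 2 =
      ‖Complex.I * ConicalLayer.layerDphi v x - (ω : ℂ) * v x‖ ^ 2 / x.1.1 ^ 2 := fun x => by
    simp only [norm_mul, mul_pow, Complex.norm_real, norm_inv, Real.norm_eq_abs, inv_pow, sq_abs]
    ring
  have hint : Integrable (fun x => ‖layerDr v x‖ ^ 2 + ‖layerDz v x‖ ^ 2
      + ‖Complex.I * ConicalLayer.layerDphi v x - (ω : ℂ) * v x‖ ^ 2 / x.1.1 ^ 2)
      (layerMeasure θ) :=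
    ((hv.layerD (1, 0)).integrable_norm_sq.add (hv.layerD (0, 1)).integrable_norm_sq).add
      ((hK.mul_left (h := fun p => ((p.1⁻¹ : ℝ) : ℂ))
        fun _ => IsGuiTest.contDiffAt_fst_inv).integrable_norm_sq.congr (.of_forall hdiv))
  rw [radialEnergy, layerForm, layerMeasure, integral_prod _ hint]
  refine integral_mono ((hv.isGuiTest_angularProj m).integrable_radialEnergy _)
    (Integrable.integral_prod_left hint) fun p => ?_
  have hi : ∀ {u : (ℝ × ℝ) × S1 → ℂ}, IsLayerTest θ u →
      Integrable (fun φ : S1 => ‖u (p, φ)‖ ^ 2) := fun hu =>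
    ((hu.continuous.comp (by fun_prop : Continuous fun φ : S1 => (p, φ))).norm.pow
      2).integrable_of_hasCompactSupport (HasCompactSupport.of_compactSpace _)
  have hr := norm_angularProj_sq_le m (hv.layerD (1, 0)).continuous p
  have hz := norm_angularProj_sq_le m (hv.layerD (0, 1)).continuous p
  have hk := norm_angularProj_sq_le m hK.continuous p
  rw [← hv.fderiv_angularProj] at hr hz
  rw [hKp, norm_mul, mul_pow, Complex.norm_real, Real.norm_eq_abs, sq_abs, neg_sq] at hk
  have hk' := div_le_div_of_nonneg_right hk (sq_nonneg p.1)
  calc _ ≤ (∫ φ : S1, ‖ConicalLayer.layerD (1, 0) v (p, φ)‖ ^ 2)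
        + (∫ φ : S1, ‖ConicalLayer.layerD (0, 1) v (p, φ)‖ ^ 2)
        + (∫ φ : S1, ‖Complex.I * ConicalLayer.layerDphi v (p, φ)
          - (ω : ℂ) * v (p, φ)‖ ^ 2) / p.1 ^ 2 := by
        rw [← mul_div_assoc]
        exact add_le_add (add_le_add hr hz) hk'
    _ = _ := by
        rw [← integral_div, ← integral_add (hi (hv.layerD (1, 0))) (hi (hv.layerD (0, 1))),
          ← integral_add (by exact (hi (hv.layerD (1, 0))).add (hi (hv.layerD (0, 1))))
            ((hi hK).div_const _)]
        rfl

end IsLayerTest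

/-! ### Comparison of the three `L²` norms -/

theorem eLpNorm_two {α : Type*} [MeasurableSpace α] (μ : Measure α) (f : α → ℂ) :
    eLpNorm f 2 μ = (∫⁻ x, ‖f x‖ₑ ^ (2 : ℝ) ∂μ) ^ (1 / 2 : ℝ) := by
  rw [eLpNorm_eq_lintegral_rpow_enorm_toReal (by norm_num) (by norm_num)]
  simp

theorem aestronglyMeasurable_radialMeasure {w : ℝ × ℝ → ℂ}
    (hw : AEStronglyMeasurable w (flatMeasure θ)) :
    AEStronglyMeasurable w (radialMeasure θ) :=
  hw.mono_ac (withDensity_absolutelyContinuous _ _)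

theorem eLpNorm_radialMeasure {w : ℝ × ℝ → ℂ} (hw : AEStronglyMeasurable w (flatMeasure θ)) :
    eLpNorm w 2 (radialMeasure θ) =
      eLpNorm (fun p => ((Real.sqrt p.1 : ℝ) : ℂ) * w p) 2 (flatMeasure θ) := by
  rw [eLpNorm_two, eLpNorm_two, radialMeasure, lintegral_withDensity_eq_lintegral_mul₀
    (by fun_prop) (hw.enorm.pow_const _)]
  congr 1
  refine lintegral_congr_ae ?_
  filter_upwards [ae_fst_pos θ] with p hp
  rw [Pi.mul_apply, enorm_mul, ENNReal.mul_rpow_of_nonneg _ _ (by norm_num)]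
  congr 1
  rw [← ofReal_norm, Complex.norm_real, Real.norm_of_nonneg (Real.sqrt_nonneg _),
    ENNReal.ofReal_rpow_of_nonneg (Real.sqrt_nonneg _) (by norm_num), Real.rpow_two,
    Real.sq_sqrt hp.le]

theorem eLpNorm_tensor {w : ℝ × ℝ → ℂ} (hw : AEStronglyMeasurable w (radialMeasure θ)) (m : ℤ) :
    eLpNorm (fun x : (ℝ × ℝ) × S1 => w x.1 * angularMode m x.2) 2 (layerMeasure θ) =
      eLpNorm w 2 (radialMeasure θ) := by
  rw [eLpNorm_two, eLpNorm_two]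
  simp_rw [enorm_mul, ENNReal.mul_rpow_of_nonneg _ _ (by norm_num : (0 : ℝ) ≤ 2)]
  rw [layerMeasure, lintegral_prod_mul (f := fun p => ‖w p‖ₑ ^ (2 : ℝ))
    (g := fun φ => ‖angularMode m φ‖ₑ ^ (2 : ℝ)) (hw.enorm.pow_const _)
    ((continuous_angularMode m).enorm.aemeasurable.pow_const _),
    lintegral_norm_angularMode_sq, mul_one]

theorem eLpNorm_angularProj_le (m : ℤ) {f : (ℝ × ℝ) × S1 → ℂ}
    (hf : AEStronglyMeasurable f (layerMeasure θ)) :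
    eLpNorm (angularProj m f) 2 (radialMeasure θ) ≤ eLpNorm f 2 (layerMeasure θ) := by
  rw [eLpNorm_two, eLpNorm_two]
  refine ENNReal.rpow_le_rpow ?_ (by norm_num)
  rw [layerMeasure, lintegral_prod _ (hf.enorm.pow_const _)]
  refine lintegral_mono_ae ?_
  filter_upwards [hf.prodMk_left] with p hp
  exact enorm_angularProj_sq_le m f p hp

theorem ae_memLp_slice {f : (ℝ × ℝ) × S1 → ℂ} (hf : MemLp f 2 (layerMeasure θ)) :
    ∀ᵐ p ∂(radialMeasure θ), MemLp (fun φ => f (p, φ)) 2 (volume : Measure S1) := by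
  have h := (memLp_two_iff_integrable_sq_norm hf.1).1 hf
  have h1 : ∀ᵐ p ∂(radialMeasure θ), AEStronglyMeasurable (fun φ => f (p, φ))
      (volume : Measure S1) := hf.1.prodMk_left
  filter_upwards [h1, h.prod_right_ae] with p hp hi
  exact (memLp_two_iff_integrable_sq_norm hp).2 hi

/-- Only almost everywhere, since slices of an `L²` function are square integrable for almost every
`p`. -/
theorem angularProj_sub_ae (m : ℤ) {f g : (ℝ × ℝ) × S1 → ℂ} (hf : MemLp f 2 (layerMeasure θ))
    (hg : MemLp g 2 (layerMeasure θ)) :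
    ∀ᵐ p ∂(radialMeasure θ), angularProj m (fun x => f x - g x) p =
      angularProj m f p - angularProj m g p := by
  have hm : MemLp (fun φ => conj (angularMode m φ)) 2 (volume : Measure S1) :=
    (continuous_angularMode m).star.memLp_of_hasCompactSupport
      (HasCompactSupport.of_compactSpace _)
  filter_upwards [ae_memLp_slice hf, ae_memLp_slice hg] with p h1 h2
  have e := integral_sub (h1.integrable_mul hm) (h2.integrable_mul hm)
  simp only [angularProj]
  refine Eq.trans ?_ e
  congr 1 with φ
  simp only [Pi.mul_apply]
  ring

theorem angularProj_tensor (m : ℤ) (w : ℝ × ℝ → ℂ) (p : ℝ × ℝ) :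
    angularProj m (fun x => w x.1 * angularMode m x.2) p = w p := by
  have e : ∀ φ : S1, w p * angularMode m φ * conj (angularMode m φ) =
      w p * (((2 * Real.pi)⁻¹ : ℝ) : ℂ) := fun φ => by
    rw [mul_assoc, Complex.mul_conj, Complex.normSq_eq_norm_sq, norm_angularMode_sq]
  have hv : (volume : Measure S1).real Set.univ = 2 * Real.pi := by
    rw [Measure.real, AddCircle.measure_univ, ENNReal.toReal_ofReal Real.two_pi_pos.le]
  simp only [angularProj, e]
  rw [integral_const, hv, Complex.real_smul, mul_left_comm, ← Complex.ofReal_mul,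
    mul_inv_cancel₀ Real.two_pi_pos.ne', Complex.ofReal_one, mul_one]

theorem tendsto_toL2_iff {φ : ℕ → ℝ × ℝ → ℂ} (hφ : ∀ n, IsGuiTest θ (φ n)) (u : L2Flat θ) :
    Tendsto (fun n => (hφ n).toL2) atTop (𝓝 u) ↔
      Tendsto (fun n => eLpNorm (fun p => φ n p - u p) 2 (flatMeasure θ)) atTop (𝓝 0) := by
  rw [Lp.tendsto_Lp_iff_tendsto_eLpNorm']
  refine tendsto_congr fun n => eLpNorm_congr_ae ?_
  filter_upwards [(hφ n).coeFn_toL2] with p hp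
  rw [Pi.sub_apply, hp]

/-! ### The domain of the flat fiber form -/

theorem fderiv_sqrt_sub_norm_sq {w w' : ℝ × ℝ → ℂ} (hw : IsGuiTest θ w) (hw' : IsGuiTest θ w')
    (e : ℝ × ℝ) :
    ‖((hw.sub hw').sqrt_mul.fderiv_apply e).toL2‖ ^ 2 =
      ‖(hw.sqrt_mul.fderiv_apply e).toL2 - (hw'.sqrt_mul.fderiv_apply e).toL2‖ ^ 2 := by
  rw [IsGuiTest.norm_sq_toL2_fderiv_sub hw.sqrt_mul hw'.sqrt_mul, IsGuiTest.norm_sq_toL2]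
  simp_rw [mul_sub]

theorem tendsto_zero_of_sq {ι : Type*} {l : Filter ι} {f : ι → ℝ} (hf : ∀ i, 0 ≤ f i)
    (h : Tendsto (fun i => f i ^ 2) l (𝓝 0)) : Tendsto f l (𝓝 0) := by
  simpa [Real.sqrt_sq (hf _)] using h.sqrt

theorem cauchySeq_of_radialEnergy {w : ℕ → ℝ × ℝ → ℂ} (hw : ∀ n, IsGuiTest θ (w n)) {c : ℝ}
    (hc : 0 < c) (h : Tendsto (fun k : ℕ × ℕ =>
      radialEnergy θ c (fun p => w k.1 p - w k.2 p)) atTop (𝓝 0)) :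
    CauchySeq (fun n => ((hw n).sqrt_mul.fderiv_apply (1, 0)).toL2) ∧
      CauchySeq (fun n => ((hw n).sqrt_mul.fderiv_apply (0, 1)).toL2) := by
  have hmin : 0 < min 1 (4 * c) := lt_min one_pos (by linarith)
  have hb : Tendsto (fun k : ℕ × ℕ => (min 1 (4 * c))⁻¹ *
      radialEnergy θ c (fun p => w k.1 p - w k.2 p)) atTop (𝓝 0) := by
    simpa using h.const_mul (min 1 (4 * c))⁻¹
  have hle : ∀ k : ℕ × ℕ, ‖((hw k.1).sqrt_mul.fderiv_apply (1, 0)).toL2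
      - ((hw k.2).sqrt_mul.fderiv_apply (1, 0)).toL2‖ ^ 2
      + ‖((hw k.1).sqrt_mul.fderiv_apply (0, 1)).toL2
      - ((hw k.2).sqrt_mul.fderiv_apply (0, 1)).toL2‖ ^ 2 ≤ (min 1 (4 * c))⁻¹ *
      radialEnergy θ c (fun p => w k.1 p - w k.2 p) := fun k => by
    have := (((hw k.1).sub (hw k.2)).radialEnergy_bounds hc).1
    rwa [fderiv_sqrt_sub_norm_sq (hw k.1) (hw k.2), fderiv_sqrt_sub_norm_sq (hw k.1) (hw k.2),
      ← le_inv_mul_iff₀ hmin] at this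
  refine ⟨cauchySeq_iff_tendsto_dist_atTop_0.2 ?_, cauchySeq_iff_tendsto_dist_atTop_0.2 ?_⟩
  all_goals
    simp_rw [dist_eq_norm]
    refine tendsto_zero_of_sq (fun _ => norm_nonneg _)
      (squeeze_zero (fun _ => by positivity) (fun k => le_trans ?_ (hle k)) hb)
  · exact le_add_of_nonneg_right (by positivity)
  · exact le_add_of_nonneg_left (by positivity)

/-- The mode `e^{imφ}` of the layer form carries the coefficient `(m + ω)²`, as
`(i∂_φ - ω) e^{imφ} = -(m + ω) e^{imφ}`; only its positivity matters for the domain. -/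
theorem flatFormDomain_subset {ω : ℝ} {m : ℤ} (hc : 0 < ((m : ℝ) + ω) ^ 2) :
    flatFormDomain θ ω m ⊆ H10 θ := by
  rintro u ⟨w, ⟨U, ⟨v, hv, hvU, hvC⟩, hwU⟩, huw⟩
  have hw := fun n => (hv n).isGuiTest_angularProj m
  have hsub : ∀ j k p, angularProj m (v j) p - angularProj m (v k) p =
      angularProj m (fun x => v j x - v k x) p := fun j k p => by
    simp only [angularProj]
    rw [← integral_sub ((hv j).integrable_mul_mode m p) ((hv k).integrable_mul_mode m p)]
    congr 1 with φ
    ring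
  have hE : Tendsto (fun k : ℕ × ℕ => radialEnergy θ (((m : ℝ) + ω) ^ 2)
      (fun p => angularProj m (v k.1) p - angularProj m (v k.2) p)) atTop (𝓝 0) := by
    refine squeeze_zero (fun k => integral_nonneg fun p => by positivity) (fun k => ?_) hvC
    simp_rw [hsub]
    exact ((hv k.1).sub (hv k.2)).radialEnergy_angularProj_le ω m
  obtain ⟨h1, h2⟩ := cauchySeq_of_radialEnergy hw hc hE
  obtain ⟨g, hg⟩ := cauchySeq_tendsto_of_complete h1
  obtain ⟨k, hk⟩ := cauchySeq_tendsto_of_complete h2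
  -- The limits `g`, `k` come from completeness alone; closedness of weak differentiation identifies
  -- them with the gradient of `u` once `L²` convergence to `u` is known.
  refine H1Approx.mem_H10 (φ := fun n p => ((Real.sqrt p.1 : ℝ) : ℂ) * angularProj m (v n) p)
    ⟨fun n => (hw n).sqrt_mul, ?_, hg, hk⟩
  rw [tendsto_toL2_iff]
  refine tendsto_of_tendsto_of_tendsto_of_le_of_le tendsto_const_nhds hvU
    (fun _ => zero_le) fun n => ?_
  have hwm : AEStronglyMeasurable (w : ℝ × ℝ → ℂ) (flatMeasure θ) := by
    obtain ⟨w', hw', hww'⟩ := Lp.aestronglyMeasurable w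
    exact ⟨w', hw', radialMeasure_ae_iff.1 hww'⟩
  calc eLpNorm (fun p => ((Real.sqrt p.1 : ℝ) : ℂ) * angularProj m (v n) p - u p) 2
        (flatMeasure θ)
      = eLpNorm (fun p => ((Real.sqrt p.1 : ℝ) : ℂ) * (angularProj m (v n) p - w p)) 2
        (flatMeasure θ) := by
        refine eLpNorm_congr_ae ?_
        filter_upwards [huw] with p hp
        rw [hp]
        ring
    _ = eLpNorm (fun p => angularProj m (v n) p - w p) 2 (radialMeasure θ) :=
        (eLpNorm_radialMeasure ((hw n).smooth.continuous.aestronglyMeasurable.sub hwm)).symm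
    _ = eLpNorm (angularProj m (fun x => v n x - U x)) 2 (radialMeasure θ) := by
        refine eLpNorm_congr_ae ?_
        filter_upwards [hwU, angularProj_sub_ae m (hv n).memLp (Lp.memLp U)] with p hp hs
        rw [hs, hp]
    _ ≤ _ := eLpNorm_angularProj_le m ((hv n).memLp.sub (Lp.memLp U)).1

/-- The preimage of `u` in the layer is `r^{-1/2} u` times the mode, approximated by `r^{-1/2} φ_n`
times the mode. Both operations are isometric in `L²`, and the form distances are controlled by the
upper Hardy bound. -/
theorem H10_subset {ω : ℝ} {m : ℤ} (hc : 0 < ((m : ℝ) + ω) ^ 2) :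
    H10 θ ⊆ flatFormDomain θ ω m := by
  intro u hu
  obtain ⟨φ, hφ⟩ := exists_h1Approx hu
  have hum : AEStronglyMeasurable
      (fun p : ℝ × ℝ => (((Real.sqrt p.1)⁻¹ : ℝ) : ℂ) * u p) (flatMeasure θ) :=
    (by fun_prop : Measurable fun p : ℝ × ℝ =>
      (((Real.sqrt p.1)⁻¹ : ℝ) : ℂ)).aestronglyMeasurable.mul (Lp.aestronglyMeasurable u)
  have hcancel : ∀ᵐ p ∂(flatMeasure θ), ((Real.sqrt p.1 : ℝ) : ℂ) *
      ((((Real.sqrt p.1)⁻¹ : ℝ) : ℂ) * u p) = u p := by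
    filter_upwards [ae_fst_pos θ] with p hp
    have : ((Real.sqrt p.1 : ℝ) : ℂ) ≠ 0 :=
      Complex.ofReal_ne_zero.2 (Real.sqrt_pos.2 hp).ne'
    push_cast
    field_simp
  have hwm : MemLp (fun p : ℝ × ℝ => (((Real.sqrt p.1)⁻¹ : ℝ) : ℂ) * u p) 2
      (radialMeasure θ) := by
    refine ⟨aestronglyMeasurable_radialMeasure hum, ?_⟩
    rw [eLpNorm_radialMeasure hum, eLpNorm_congr_ae hcancel]
    exact (Lp.memLp u).2
  have hUm : MemLp (fun x : (ℝ × ℝ) × S1 =>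
      ((((Real.sqrt x.1.1)⁻¹ : ℝ) : ℂ) * u x.1) * angularMode m x.2) 2 (layerMeasure θ) := by
    refine ⟨?_, ?_⟩
    · exact (hwm.1.comp_fst (ν := (volume : Measure S1))).mul
        ((continuous_angularMode m).comp continuous_snd).aestronglyMeasurable
    · rw [eLpNorm_tensor hwm.1]
      exact hwm.2
  have hw := fun n => (hφ.test n).sqrt_inv_mul
  refine ⟨hwm.toLp _, ⟨hUm.toLp _, ⟨fun n x =>
    ((((Real.sqrt x.1.1)⁻¹ : ℝ) : ℂ) * φ n x.1) * angularMode m x.2,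
    fun n => (hw n).tensor m, ?_, ?_⟩, ?_⟩, ?_⟩
  · refine ((tendsto_toL2_iff hφ.test u).1 hφ.tendsto).congr fun n => ?_
    calc eLpNorm (fun p => φ n p - u p) 2 (flatMeasure θ)
        = eLpNorm (fun p => ((Real.sqrt p.1 : ℝ) : ℂ) *
            ((((Real.sqrt p.1)⁻¹ : ℝ) : ℂ) * φ n p - (((Real.sqrt p.1)⁻¹ : ℝ) : ℂ) * u p)) 2
            (flatMeasure θ) := by
          refine eLpNorm_congr_ae ?_
          filter_upwards [hcancel] with p hp
          rw [mul_sub, hp, congrFun (hφ.test n).sqrt_mul_sqrt_inv_mul p]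
      _ = eLpNorm (fun p => (((Real.sqrt p.1)⁻¹ : ℝ) : ℂ) * φ n p
            - (((Real.sqrt p.1)⁻¹ : ℝ) : ℂ) * u p) 2 (radialMeasure θ) :=
          (eLpNorm_radialMeasure
            ((hw n).smooth.continuous.aestronglyMeasurable.sub hum)).symm
      _ = _ := by
          refine (eLpNorm_tensor (aestronglyMeasurable_radialMeasure
            ((hw n).smooth.continuous.aestronglyMeasurable.sub hum)) m).symm.trans
            (eLpNorm_congr_ae ?_)
          filter_upwards [hUm.coeFn_toLp] with x hx
          rw [hx]
          simp only [Pi.sub_apply]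
          ring
  · have e : ∀ k : ℕ × ℕ, layerForm θ ω (fun x =>
        ((((Real.sqrt x.1.1)⁻¹ : ℝ) : ℂ) * φ k.1 x.1) * angularMode m x.2
        - ((((Real.sqrt x.1.1)⁻¹ : ℝ) : ℂ) * φ k.2 x.1) * angularMode m x.2) =
        radialEnergy θ (((m : ℝ) + ω) ^ 2) (fun p => (((Real.sqrt p.1)⁻¹ : ℝ) : ℂ) * φ k.1 p
          - (((Real.sqrt p.1)⁻¹ : ℝ) : ℂ) * φ k.2 p) := fun k => by
      rw [← ((hw k.1).sub (hw k.2)).layerForm_tensor ω m]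
      simp_rw [sub_mul]
    simp_rw [e]
    have hn : ∀ (e : ℝ × ℝ) (k : ℕ × ℕ),
        ‖(((hw k.1).sub (hw k.2)).sqrt_mul.fderiv_apply e).toL2‖ =
        dist ((hφ.test k.1).fderiv_apply e).toL2 ((hφ.test k.2).fderiv_apply e).toL2 := by
      intro e k
      refine (sq_eq_sq₀ (norm_nonneg _) dist_nonneg).1 ?_
      rw [dist_eq_norm, IsGuiTest.norm_sq_toL2_fderiv_sub (hφ.test k.1) (hφ.test k.2),
        IsGuiTest.norm_sq_toL2]
      simp_rw [mul_sub, fun n p => congrFun (hφ.test n).sqrt_mul_sqrt_inv_mul p]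
    have hr := (cauchySeq_iff_tendsto_dist_atTop_0.1 hφ.tendsto_r.cauchySeq).pow 2
    have hz := (cauchySeq_iff_tendsto_dist_atTop_0.1 hφ.tendsto_z.cauchySeq).pow 2
    have hb := (hr.add hz).const_mul (1 + 4 * ((m : ℝ) + ω) ^ 2)
    simp only [ne_eq, OfNat.ofNat_ne_zero, not_false_eq_true, zero_pow, add_zero, mul_zero] at hb
    refine squeeze_zero (fun k => integral_nonneg fun p => by positivity) (fun k => ?_) hb
    have := (((hw k.1).sub (hw k.2)).radialEnergy_bounds hc).2
    rwa [hn, hn] at this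
  · have h : ∀ᵐ p ∂(radialMeasure θ), ∀ᵐ φ : S1, hUm.toLp _ (p, φ) =
        ((((Real.sqrt p.1)⁻¹ : ℝ) : ℂ) * u p) * angularMode m φ :=
      Measure.ae_ae_of_ae_prod hUm.coeFn_toLp
    filter_upwards [hwm.coeFn_toLp, h] with p hp hU
    rw [hp, ← angularProj_tensor m (fun p => (((Real.sqrt p.1)⁻¹ : ℝ) : ℂ) * u p) p]
    refine integral_congr_ae ?_
    filter_upwards [hU] with ψ hψ
    rw [hψ]
  · filter_upwards [hcancel, radialMeasure_ae_iff.1 hwm.coeFn_toLp] with p h1 h2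
    rw [h2, h1]

theorem flatFormDomain_eq {ω : ℝ} {m : ℤ} (hc : 0 < ((m : ℝ) + ω) ^ 2) :
    flatFormDomain θ ω m = H10 θ :=
  (flatFormDomain_subset hc).antisymm (H10_subset hc)

theorem intCast_add_ne_zero {ω : ℝ} (hω : ω ∈ Set.Ioc (0 : ℝ) (1 / 2)) (m : ℤ) :
    (m : ℝ) + ω ≠ 0 := by
  intro h
  -- If `m = -ω`, then `m` would be an integer strictly between `-1` and `0`.
  have h1 : ((-1 : ℤ) : ℝ) < m := by push_cast; linarith [hω.2]
  have h2 : (m : ℝ) < ((0 : ℤ) : ℝ) := by push_cast; linarith [hω.1]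
  have h1' := Int.cast_lt.1 h1
  have h2' := Int.cast_lt.1 h2
  omega

end ConicalLayer
end

/-! ### Form domain, form core and equivalence of norms -/

theorem propositionB1 (θ : ℝ) (hθ : θ ∈ Set.Ioo 0 (Real.pi / 2))
    (ω : ℝ) (hω : ω ∈ Set.Ioc (0 : ℝ) (1 / 2)) (m : ℤ) :
    ConicalLayer.flatFormDomain θ ω m = ConicalLayer.H10 θ ∧
    ConicalLayer.TestIsFormCore θ ω m ∧
    (∀ u ∈ ConicalLayer.flatFormDomain θ ω m,
      Integrable (fun p : ℝ × ℝ => ‖u p‖ ^ 2 / p.1 ^ 2) (ConicalLayer.flatMeasure θ) ∧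
      0 ≤ ConicalLayer.flatForm θ ω m u) ∧
    ∃ C₁ C₂ : ℝ, 0 < C₁ ∧ 0 < C₂ ∧ ∀ u ∈ ConicalLayer.flatFormDomain θ ω m,
      C₁ * ConicalLayer.h1Norm θ u ≤ ConicalLayer.flatFormNorm θ ω m u ∧
      ConicalLayer.flatFormNorm θ ω m u ≤ C₂ * ConicalLayer.h1Norm θ u := by
  have hc : 0 < ((m : ℝ) + ω) ^ 2 := sq_pos_of_ne_zero (ConicalLayer.intCast_add_ne_zero hω m)
  have hγ : 0 < ((m : ℝ) - ω) ^ 2 := by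
    -- Replacing `m` by `-m` covers the other sign, as `m - ω = 0` would give `-m + ω = 0`.
    have h := ConicalLayer.intCast_add_ne_zero hω (-m)
    refine sq_pos_of_ne_zero fun h' => h ?_
    push_cast
    linarith
  have hdom := ConicalLayer.flatFormDomain_eq (θ := θ) hc
  rw [hdom]
  refine ⟨rfl, ⟨?_, ?_⟩, fun u hu => ⟨ConicalLayer.integrable_norm_sq_div hu,
    (ConicalLayer.norm_comparison ω m hγ hu).1⟩, _, _, ?_, ?_,
    fun u hu => (ConicalLayer.norm_comparison ω m hγ hu).2⟩
  · intro u hu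
    obtain ⟨φ, hφ, rfl⟩ := ConicalLayer.testClasses_eq_toL2 hu
    rw [hdom]
    exact hφ.h1Approx.mem_H10
  · intro u hu
    rw [hdom] at hu
    obtain ⟨φ, hφ⟩ := ConicalLayer.exists_h1Approx hu
    refine ⟨fun n => (hφ.test n).toL2, fun n => (hφ.test n).toL2_mem, ?_⟩
    -- `H¹` approximants also converge in the form norm, by the upper comparison applied to the
    -- differences, which lie in `H₀¹`.
    have hlim := hφ.tendsto_h1Norm.const_mul (Real.sqrt (1 + 4 * ((m : ℝ) - ω) ^ 2))
    rw [mul_zero] at hlim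
    exact squeeze_zero (fun n => Real.sqrt_nonneg _) (fun n =>
      (ConicalLayer.norm_comparison ω m hγ
        (ConicalLayer.H10_sub_mem (hφ.test n).h1Approx.mem_H10 hu)).2.2) hlim
  · exact Real.sqrt_pos.2 (lt_min one_pos (by linarith))
  · positivity
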